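/- Let $M$ be a closed smooth Riemannian $n$-manifold with geodesic distance $r$, let $|\cdot|_p$ be the norm induced by the metric on $\bigwedge^* T_p^*M$, and for forms $\omega$ on $M$ put $\|\omega\|=\big(\int_M|\omega|_p^2\,dV\big)^{1/2}$ and $\|\omega\|_\infty=\sup_{p\in M}|\omega|_p$. Let $\Omega(M)=\bigoplus_k\Omega^k(M)$ be the smooth forms. For a smooth triangulation $K$ of $M$ with ordered vertices and barycentric coordinates $\mu_i$, let $C=C(K)$ be the real simplicial cochains with coboundary $\delta$; let $R:\Omega(M)\to C$ be the de Rham map $R\omega(\sigma)=\int_\sigma\omega$; let $W$ be the Whitney map, i.e. the linear map with $$W[p_0,\dots,p_k]=k!\sum_{i=0}^k(-1)^i\mu_i\,d\mu_0\wedge\cdots\wedge\widehat{d\mu_i}\wedge\cdots\wedge d\mu_k ,$$ which is a form defined almost everywhere on $M$; and let $a\cup b=R(Wa\wedge Wb)$. The mesh $\eta=\eta(K)$ is the supremum of $r(p,q)$ over the edges $[p,q]$ of $K$, and the fullness $\Theta(K)$ is the infimum of $\mathrm{vol}(\sigma)/\eta^n$ over the $n$-simplices $\sigma$ of $K$. For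 $\Lambda\ge 0$ say that $K$ is $\Lambda$-commensurable if on every closed simplex of $K$ there is a Euclidean metric $e$, affine in the barycentric coordinates, with $r\le\Lambda e$ and $e\le\Lambda r$ on this simplex. (All subdivisions, affine in the barycentric coordinates, of one fixed smooth triangulation are $\Lambda$-commensurable for a common $\Lambda$.) A canonical local extension of $(C,\delta,\cup)$ to a $\mathcal C_\infty$-algebra is a rule that assigns to every finite ordered simplicial complex $K$ a $\mathcal C_\infty$-algebra structure $m_1=\delta,\ m_2=\cup,\ m_3,\dots$ on $C(K)$ (with $m_j$ of degree $2-j$) and that commutes with pull back along order preserving injective simplicial maps; in particular the value of $m_j(c_1,\dots,c_j)$ on a simplex depends only on the restrictions of the $c_i$ to that closed simplex, by a rule independent of $K$. Sullivan's local inductive construction yields such extensions. Fix any one of them. **Theorem.** Let $\Theta_0>0$ and $\Lambda\ge0$. For every $j\ge 3$ there is a constant $\lambda$, independent of $K$ and of the forms, such that for every $\Lambda$-commensurable smooth triangulation $K$ of $M$ with $\Theta(K)\ge\Theta_0$ and mesh $0\le\eta\le1$, $$\| W( m_j ( R\omega_1 , \dots , R\omega_j)) \| \le \lambda \cdot \prod_{i=1}^j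 \|\omega_i\|_{\infty} \cdot \eta\qquad\text{for all }\omega_1,\dots,\omega_j\in\Omega(M).$$ Consequently all higher homotopies tend to zero with the mesh: if $K_1,K_2,\dots$ are $\Lambda$-commensurable smooth triangulations of $M$ with $\Theta(K_i)\ge\Theta_0$ and $\eta(K_i)\to0$, then for all $j\ge3$ and all $\omega_1,\dots,\omega_j\in\Omega(M)$ one has $\| W( m_j ( R\omega_1 , \dots , R\omega_j)) \|\to0$ along this sequence. -/

import Mathlib

open scoped Manifold ContDiff ENNReal NNReal Topology
open MeasureTheory Bundle

noncomputable section

namespace WhitneyCochains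

/-! ### Ordered simplicial complexes and their real cochains -/

/-- The `k`-simplices `[v 0, …, v k]` of a finite simplicial complex whose vertices are ordered
(the vertex set is `Fin N`), written with increasing vertices. -/
def Simplex {N : ℕ} (K : AbstractSimplicialComplex (Fin N)) (k : ℕ) : Type :=
  {v : Fin (k + 1) ↪o Fin N // Finset.univ.map v.toEmbedding ∈ K.faces}

instance {N : ℕ} (K : AbstractSimplicialComplex (Fin N)) (k : ℕ) : Finite (Simplex K k) :=
  Subtype.finite

instance {N : ℕ} (K : AbstractSimplicialComplex (Fin N)) (k : ℕ) : Fintype (Simplex K k) :=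
  Fintype.ofFinite _

variable {N : ℕ} {K : AbstractSimplicialComplex (Fin N)}

lemma mem_faces_of_subset {s t : Finset (Fin N)} (hs : s ∈ K.faces) (hts : t ⊆ s)
    (ht : t.Nonempty) : t ∈ K.faces :=
  (K.isRelLowerSet_faces hs).2 hts ht

/-- The face of a `(k+1)`-simplex obtained by deleting the `i`-th vertex. -/
def Simplex.face {k : ℕ} (v : Simplex K (k + 1)) (i : Fin (k + 2)) : Simplex K k :=
  ⟨(Fin.succAboveOrderEmb i).trans v.1, by
    refine mem_faces_of_subset v.2 ?_ (by simp)
    intro x hx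
    simp only [Finset.mem_map, Finset.mem_univ, true_and] at hx ⊢
    obtain ⟨a, rfl⟩ := hx
    exact ⟨i.succAbove a, rfl⟩⟩

/-- The total space `C = ⨁ₖ Cᵏ` of real simplicial cochains. (There are no `k`-simplices for
`k ≥ N`, so that the product below is the direct sum.) -/
abbrev Cochain {N : ℕ} (K : AbstractSimplicialComplex (Fin N)) : Type :=
  ∀ k : ℕ, Simplex K k → ℝ

/-- The grading of the cochains: `Cᵈ` consists of the cochains that vanish on all simplices of
dimension different from `d`. -/
def cochainGrading {N : ℕ} (K : AbstractSimplicialComplex (Fin N)) (d : ℤ) :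
    Submodule ℝ (Cochain K) where
  carrier := {c | ∀ k : ℕ, (k : ℤ) ≠ d → c k = 0}
  zero_mem' := fun _ _ => rfl
  add_mem' := fun {a b} ha hb k hk => by
    rw [Pi.add_apply, ha k hk, hb k hk, add_zero]
  smul_mem' := fun r a ha k hk => by
    rw [Pi.smul_apply, ha k hk, smul_zero]

/-- The coboundary operator. -/
def coboundary (c : Cochain K) : Cochain K
  | 0 => 0
  | k + 1 => fun v => ∑ i : Fin (k + 2), (-1 : ℝ) ^ (i : ℕ) * c k (v.face i)

/-! ### Exterior algebra -/

section Exterior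

variable {V : Type*} [AddCommGroup V] [Module ℝ V]

/-- `ℓ 0 ∧ ⋯ ∧ ℓ (k-1)`, with the convention
`(ℓ 0 ∧ ⋯ ∧ ℓ (k-1)) (v 0, …, v (k-1)) = det (ℓ j (v i))`. -/
def wedgeCovectors {k : ℕ} (l : Fin k → (V →ₗ[ℝ] ℝ)) : V [⋀^Fin k]→ₗ[ℝ] ℝ :=
  (Matrix.detRowAlternating (R := ℝ) (n := Fin k)).compLinearMap (LinearMap.pi l)

/-- The Whitney expression `k! ∑ᵢ (-1)ⁱ μᵢ dμ₀ ∧ ⋯ ∧ (omit dμᵢ) ∧ ⋯ ∧ dμₖ` at one point, as a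
function of the values `μᵢ` and the differentials `dμᵢ` at that point. -/
def whitneyExpr {k : ℕ} (mu : Fin (k + 1) → ℝ) (dmu : Fin (k + 1) → (V →ₗ[ℝ] ℝ)) :
    V [⋀^Fin k]→ₗ[ℝ] ℝ :=
  (k.factorial : ℝ) •
    ∑ i : Fin (k + 1), ((-1 : ℝ) ^ (i : ℕ) * mu i) • wedgeCovectors fun j => dmu (i.succAbove j)

/-- The wedge product of two elements of the (total) exterior algebra of `V*`. -/
def wedge (a b : ∀ k : ℕ, V [⋀^Fin k]→ₗ[ℝ] ℝ) (m : ℕ) : V [⋀^Fin m]→ₗ[ℝ] ℝ :=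
  ∑ k : Fin (m + 1),
    ((LinearMap.mul' ℝ ℝ).compAlternatingMap
      ((a k).domCoprod (b (m - k)))).domDomCongr
        (finSumFinEquiv.trans (finCongr (by omega)))

end Exterior

/-- The norm on the exterior algebra of `V*` induced by an inner product on `V`: the elements
`e^{i₁} ∧ ⋯ ∧ e^{iₖ}`, `i₁ < ⋯ < iₖ`, are orthonormal, where `e` is an orthonormal basis of `V`. -/
def formNorm {V : Type*} [NormedAddCommGroup V] [InnerProductSpace ℝ V] [FiniteDimensional ℝ V]
    (a : ∀ k : ℕ, V [⋀^Fin k]→ₗ[ℝ] ℝ) : ℝ :=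
  √(∑ k ∈ Finset.range (Module.finrank ℝ V + 1), ∑ i : Fin k ↪o Fin (Module.finrank ℝ V),
    (a k fun j => stdOrthonormalBasis ℝ V (i j)) ^ 2)

/-! ### Geometric realization; Whitney map, integration and product on the realization -/

/-- The closed standard simplex `{t | 0 ≤ tᵢ, ∑ tᵢ ≤ 1}` in `ℝᵏ`. -/
def corner (k : ℕ) : Set (EuclideanSpace ℝ (Fin k)) :=
  {t | (∀ i, 0 ≤ t i) ∧ ∑ i, t i ≤ 1}

/-- The point of `ℝᴺ` with barycentric coordinates `(1 - ∑ tᵢ, t₁, …, tₖ)` with respect to the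
vertices of `v`. -/
def bary {k : ℕ} (v : Simplex K k) (t : EuclideanSpace ℝ (Fin k)) : Fin N → ℝ :=
  ∑ i : Fin (k + 1), (Fin.cons (1 - ∑ j, t j) (fun j => t j) : Fin (k + 1) → ℝ) i •
    Pi.single (v.1 i) 1

/-- The geometric realization `|K|`, as a subset of `ℝᴺ`. The functions `x ↦ x i` are the
barycentric coordinates. -/
def realization {N : ℕ} (K : AbstractSimplicialComplex (Fin N)) : Set (Fin N → ℝ) :=
  {x | (∀ i, 0 ≤ x i) ∧ ∑ i, x i = 1 ∧ Finset.univ.filter (fun i => x i ≠ 0) ∈ K.faces}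

lemma zero_mem_corner (k : ℕ) : (0 : EuclideanSpace ℝ (Fin k)) ∈ corner k := by
  simp [corner]

lemma bary_mem {k : ℕ} (v : Simplex K k) {t : EuclideanSpace ℝ (Fin k)} (ht : t ∈ corner k) :
    bary v t ∈ realization K := by
  have hc : ∀ i : Fin (k + 1),
      0 ≤ (Fin.cons (1 - ∑ j, t j) (fun j => t j) : Fin (k + 1) → ℝ) i := by
    intro i
    refine Fin.cases ?_ (fun j => ?_) i
    · simpa using ht.2
    · simpa using ht.1 j
  have hsum : ∑ a, bary v t a = 1 := by
    simp only [bary, Finset.sum_apply, Pi.smul_apply, smul_eq_mul]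
    rw [Finset.sum_comm]
    simp only [← Finset.mul_sum, Finset.sum_pi_single', Finset.mem_univ, if_true, mul_one]
    simp [Fin.sum_univ_succ]
  refine ⟨fun a => ?_, hsum, mem_faces_of_subset v.2 ?_ ?_⟩
  · simp only [bary, Finset.sum_apply, Pi.smul_apply, smul_eq_mul]
    refine Finset.sum_nonneg fun i _ => mul_nonneg (hc i) ?_
    by_cases h : a = v.1 i <;> simp [h]
  · intro a ha
    simp only [Finset.mem_filter, Finset.mem_univ, true_and] at ha
    by_contra hne
    refine ha ?_
    simp only [bary, Finset.sum_apply, Pi.smul_apply, smul_eq_mul]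
    refine Finset.sum_eq_zero fun i _ => ?_
    have h : a ≠ v.1 i := fun h => hne (by simp [h])
    simp [h]
  · by_contra hne
    rw [Finset.not_nonempty_iff_eq_empty, Finset.filter_eq_empty_iff] at hne
    have h0 : ∑ a, bary v t a = 0 :=
      Finset.sum_eq_zero fun a ha => not_not.1 (hne ha)
    exact zero_ne_one (h0.symm.trans hsum)

open Classical in
/-- The affine parametrization of a closed simplex of `|K|` by the standard simplex (extended to
`ℝᵏ` by a constant). -/
def simplexPoint {k : ℕ} (v : Simplex K k) (t : EuclideanSpace ℝ (Fin k)) : realization K :=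
  if ht : t ∈ corner k then ⟨bary v t, bary_mem v ht⟩
  else ⟨bary v 0, bary_mem v (zero_mem_corner k)⟩

/-- The Whitney form of a cochain, restricted to the closed simplex `v` of `|K|`, in the
coordinates `t` of `v`. -/
def whitneyOn {m : ℕ} (v : Simplex K m) (c : Cochain K) (t : EuclideanSpace ℝ (Fin m)) (k : ℕ) :
    EuclideanSpace ℝ (Fin m) [⋀^Fin k]→ₗ[ℝ] ℝ :=
  ∑ s : Simplex K k, c k s •
    whitneyExpr (fun i => bary v t (s.1 i))
      (fun i => (fderiv ℝ (fun u => bary v u (s.1 i)) t : EuclideanSpace ℝ (Fin m) →ₗ[ℝ] ℝ))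

/-- The cochain product `a ∪ b = R (W a ∧ W b)`. -/
def cup (a b : Cochain K) : Cochain K := fun m v =>
  ∫ t in corner m, wedge (whitneyOn v a t) (whitneyOn v b t) m
    fun i => EuclideanSpace.single i (1 : ℝ)

/-! ### `C_∞`-algebras -/

/-- The Koszul sign (times the signature) of the permutation `σ` acting on homogeneous elements
of degrees `d i`. -/
def koszulSign {k : ℕ} (σ : Equiv.Perm (Fin k)) (d : Fin k → ℤ) : ℝ :=
  ∏ i, ∏ j, if i < j ∧ σ j < σ i then (-1 : ℝ) ^ (1 + d i * d j) else 1

/-- `σ` is a `(p, q)`-shuffle: it preserves the order of the first `p` elements, and the order of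
the last `q` elements. -/
def IsShuffle (p q : ℕ) (σ : Equiv.Perm (Fin (p + q))) : Prop :=
  StrictMono (fun i : Fin p => σ (Fin.castAdd q i)) ∧
    StrictMono (fun i : Fin q => σ (Fin.natAdd p i))

open Classical in
/-- A family `m₁, m₂, m₃, …` of operations on a graded real vector space is a `C_∞`-algebra
structure: `m j` has degree `2 - j`, the family satisfies the Stasheff relations (it is the family
of components of a square zero coderivation of degree 1 of the tensor coalgebra on the shifted
space), and every `m j` vanishes on (signed) shuffles (the coderivation descends to the free Lie
coalgebra). There is no `0`-ary operation. -/
structure IsCInfinity {C : Type*} [AddCommGroup C] [Module ℝ C] (G : ℤ → Submodule ℝ C)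
    (m : ∀ j : ℕ, MultilinearMap ℝ (fun _ : Fin j => C) C) : Prop where
  zero_ary : m 0 = 0
  degree : ∀ (j : ℕ) (d : Fin j → ℤ) (a : Fin j → C), (∀ i, a i ∈ G (d i)) →
    m j a ∈ G (∑ i, d i + 2 - j)
  stasheff : ∀ (k : ℕ) (d : ℕ → ℤ) (a : ℕ → C), (∀ i, a i ∈ G (d i)) →
    ∑ r ∈ Finset.range k, ∑ s ∈ Finset.Icc 1 (k - r),
      (-1 : ℝ) ^ ((r : ℤ) + s * (k - r - s : ℤ) + s * ∑ i ∈ Finset.range r, d i) •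
        m (r + 1 + (k - r - s)) (fun i =>
          if (i : ℕ) < r then a i
          else if (i : ℕ) = r then m s (fun l => a (r + l))
          else a (i + s - 1)) = 0
  shuffle : ∀ (p q : ℕ), 1 ≤ p → 1 ≤ q → ∀ (d : Fin (p + q) → ℤ) (a : Fin (p + q) → C),
    (∀ i, a i ∈ G (d i)) →
    ∑ σ : Equiv.Perm (Fin (p + q)),
      (if IsShuffle p q σ then koszulSign σ d • m (p + q) (fun i => a (σ.symm i)) else 0) = 0

/-- An order preserving injective simplicial map `f : L → K`, applied to a simplex. -/
def Simplex.map {N' : ℕ} {L : AbstractSimplicialComplex (Fin N')} {k : ℕ} (v : Simplex L k)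
    (f : Fin N' ↪o Fin N) (hf : ∀ s ∈ L.faces, s.map f.toEmbedding ∈ K.faces) : Simplex K k :=
  ⟨v.1.trans f, by
    have h := hf _ v.2
    rw [Finset.map_map] at h
    exact h⟩

/-- The pull back of cochains under an order preserving injective simplicial map. For the
inclusion of a closed simplex this is the restriction to that simplex. -/
def pullback {N' : ℕ} {L : AbstractSimplicialComplex (Fin N')}
    (f : Fin N' ↪o Fin N) (hf : ∀ s ∈ L.faces, s.map f.toEmbedding ∈ K.faces)
    (c : Cochain K) : Cochain L :=
  fun k v => c k (v.map f hf)

/-- A canonical local extension of `(C, δ, ∪)` to a `C_∞`-algebra: a construction that assigns to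
every finite ordered simplicial complex a `C_∞`-algebra structure on its cochains with
`m₁ = δ` and `m₂ = ∪`, and that commutes with the pull back under order preserving injective
simplicial maps. Applied to the inclusions of closed simplices, this says that the value of
`m_j (c₁, …, c_j)` on a simplex depends only on the restrictions of the `cᵢ` to this closed
simplex (locality), by a rule that is the same for all `k`-simplices of all complexes
(canonicity). -/
structure CanonicalLocalExtension where
  /-- the operations -/
  m : ∀ {N : ℕ} (K : AbstractSimplicialComplex (Fin N)) (j : ℕ),
    MultilinearMap ℝ (fun _ : Fin j => Cochain K) (Cochain K)
  isCInfinity : ∀ {N : ℕ} (K : AbstractSimplicialComplex (Fin N)),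
    IsCInfinity (cochainGrading K) (m K)
  m_one : ∀ {N : ℕ} (K : AbstractSimplicialComplex (Fin N)) (c : Fin 1 → Cochain K),
    m K 1 c = coboundary (c 0)
  m_two : ∀ {N : ℕ} (K : AbstractSimplicialComplex (Fin N)) (c : Fin 2 → Cochain K),
    m K 2 c = cup (c 0) (c 1)
  natural : ∀ {N N' : ℕ} (K : AbstractSimplicialComplex (Fin N))
    (L : AbstractSimplicialComplex (Fin N')) (f : Fin N' ↪o Fin N)
    (hf : ∀ s ∈ L.faces, s.map f.toEmbedding ∈ K.faces) (j : ℕ) (c : Fin j → Cochain K),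
    pullback f hf (m K j c) = m L j (fun i => pullback f hf (c i))

/-! ### Smooth forms on a closed Riemannian manifold -/

section Manifold

variable (n : ℕ) (M : Type*) [EMetricSpace M] [ChartedSpace (EuclideanSpace ℝ (Fin n)) M]

/-- Smooth differential forms on `M`, i.e. the elements of `Ω(M) = ⨁ₖ Ωᵏ(M)` (the components of
degree `k > n` are zero because they are alternating). Smoothness is smoothness of the coordinate
expressions in the charts. -/
structure SmoothForm where
  /-- the value of the degree `k` component at `p` -/
  val : ∀ (p : M) (k : ℕ), TangentSpace (𝓡 n) p [⋀^Fin k]→L[ℝ] ℝ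
  smooth : ∀ (k : ℕ) (p₀ : M), ContDiffOn ℝ ∞
    (fun y : EuclideanSpace ℝ (Fin n) =>
      ((val ((extChartAt (𝓡 n) p₀).symm y) k).compContinuousLinearMap
        (mfderiv 𝓘(ℝ, EuclideanSpace ℝ (Fin n)) (𝓡 n) (extChartAt (𝓡 n) p₀).symm y) :
        EuclideanSpace ℝ (Fin n) [⋀^Fin k]→L[ℝ] ℝ))
    (extChartAt (𝓡 n) p₀).target

/-- Smooth triangulations of `M` by a finite complex with `N` ordered vertices: a homeomorphism
`|K| → M` whose restriction to every closed simplex is smooth with injective differential. -/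
structure SmoothTriangulation (N : ℕ) where
  /-- the simplicial complex -/
  K : AbstractSimplicialComplex (Fin N)
  /-- the homeomorphism -/
  homeo : realization K ≃ₜ M
  smooth : ∀ {k : ℕ} (v : Simplex K k),
    ContMDiffOn 𝓘(ℝ, EuclideanSpace ℝ (Fin k)) (𝓡 n) ∞ (fun t => homeo (simplexPoint v t))
      (corner k)
  immersive : ∀ {k : ℕ} (v : Simplex K k), ∀ t ∈ corner k,
    Function.Injective (mfderivWithin 𝓘(ℝ, EuclideanSpace ℝ (Fin k)) (𝓡 n)
      (fun t => homeo (simplexPoint v t)) (corner k) t)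

end Manifold

section Triangulation

variable {n : ℕ} {M : Type*} [EMetricSpace M] [ChartedSpace (EuclideanSpace ℝ (Fin n)) M]

/-- The parametrization of a closed simplex of the triangulation by the standard simplex. -/
def SmoothTriangulation.param (T : SmoothTriangulation n M N) {k : ℕ} (v : Simplex T.K k)
    (t : EuclideanSpace ℝ (Fin k)) : M :=
  T.homeo (simplexPoint v t)

/-- The barycentric coordinate `μᵢ` of the `i`-th vertex, as a function on `M`. -/
def SmoothTriangulation.mu (T : SmoothTriangulation n M N) (i : Fin N) (p : M) : ℝ :=
  (T.homeo.symm p).1 i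

/-- The differential of `μᵢ`; it is meaningful in the interiors of the `n`-simplices, hence
almost everywhere. -/
def SmoothTriangulation.dmu (T : SmoothTriangulation n M N) (i : Fin N) (p : M) :
    TangentSpace (𝓡 n) p →ₗ[ℝ] ℝ :=
  (mfderiv (𝓡 n) 𝓘(ℝ, ℝ) (T.mu i) p : TangentSpace (𝓡 n) p →L[ℝ] ℝ).toLinearMap

/-- The Whitney map `W` from cochains to (almost everywhere defined) forms on `M`. -/
def SmoothTriangulation.whitney (T : SmoothTriangulation n M N) (c : Cochain T.K) (p : M) (k : ℕ) :
    TangentSpace (𝓡 n) p [⋀^Fin k]→ₗ[ℝ] ℝ :=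
  ∑ s : Simplex T.K k, c k s • whitneyExpr (fun i => T.mu (s.1 i) p) (fun i => T.dmu (s.1 i) p)

/-- The de Rham map `R`: integration of forms over the simplices of the triangulation. -/
def SmoothTriangulation.deRham (T : SmoothTriangulation n M N) (w : SmoothForm n M) :
    Cochain T.K := fun k v =>
  ∫ t in corner k, w.val (T.param v t) k fun i =>
    mfderivWithin 𝓘(ℝ, EuclideanSpace ℝ (Fin k)) (𝓡 n) (T.param v) (corner k) t
      (EuclideanSpace.single i (1 : ℝ))

/-- The mesh: the supremum of the geodesic distances of the end points of the edges. -/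
def SmoothTriangulation.mesh (T : SmoothTriangulation n M N) : ℝ≥0∞ :=
  ⨆ e : Simplex T.K 1, edist (T.param e 0) (T.param e (EuclideanSpace.single 0 1))

/-- The closed simplices of the triangulation are commensurable with Euclidean simplices, with
constant `Λ`: every closed simplex carries a Euclidean metric, affine in the barycentric
coordinates, whose distance differs from the geodesic distance of `M` by a factor of at
most `Λ`. -/
def SmoothTriangulation.IsCommensurable (T : SmoothTriangulation n M N) (Λ : ℝ≥0) : Prop :=
  ∀ (k : ℕ) (v : Simplex T.K k),
    ∃ A : EuclideanSpace ℝ (Fin k) ≃L[ℝ] EuclideanSpace ℝ (Fin k),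
      ∀ s ∈ corner k, ∀ t ∈ corner k,
        edist (T.param v s) (T.param v t) ≤ Λ * edist (A s) (A t) ∧
        edist (A s) (A t) ≤ Λ * edist (T.param v s) (T.param v t)

section Volume

variable [MeasurableSpace M] [BorelSpace M]

variable (n M) in
/-- The Riemannian volume measure of an `n`-dimensional Riemannian manifold with its geodesic
distance: the `n`-dimensional Hausdorff measure, normalized so as to agree with Lebesgue measure
on `n`-dimensional Euclidean space. -/
def riemannianVolume : Measure M := μHE[n]

/-- The fullness: the infimum of `vol σ / ηⁿ` over the `n`-simplices `σ`. -/
def SmoothTriangulation.fullness (T : SmoothTriangulation n M N) : ℝ≥0∞ :=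
  ⨅ v : Simplex T.K n, riemannianVolume n M (T.param v '' corner n) / T.mesh ^ n

end Volume

section Norms

variable [RiemannianBundle (fun x : M => TangentSpace (𝓡 n) x)]

instance (p : M) : FiniteDimensional ℝ (TangentSpace (𝓡 n) p) :=
  inferInstanceAs (FiniteDimensional ℝ (EuclideanSpace ℝ (Fin n)))

/-- The norm `|a|_p` on the exterior algebra of `T*ₚM` given by the Riemannian metric. -/
def pointwiseNorm (p : M) (a : ∀ k : ℕ, TangentSpace (𝓡 n) p [⋀^Fin k]→ₗ[ℝ] ℝ) : ℝ :=
  formNorm a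

/-- The supremum norm `‖w‖_∞ = sup_p |w|_p` of a smooth form. -/
def SmoothForm.supNorm (w : SmoothForm n M) : ℝ≥0∞ :=
  ⨆ p : M, ENNReal.ofReal (pointwiseNorm p fun k => (w.val p k).toAlternatingMap)

/-- The `L²`-norm `‖α‖ = (∫_M |α|_p² dV)^(1/2)`. -/
def l2Norm [MeasurableSpace M] [BorelSpace M]
    (a : ∀ (p : M) (k : ℕ), TangentSpace (𝓡 n) p [⋀^Fin k]→ₗ[ℝ] ℝ) : ℝ≥0∞ :=
  eLpNorm (fun p => pointwiseNorm p (a p)) 2 (riemannianVolume n M)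

end Norms

end Triangulation

end WhitneyCochains

end

/-!
The estimate is pointwise almost everywhere: at a point `p` in the interior of an `n`-simplex, the
degree `k` component of `W (m_j (R ω₁, …, R ω_j))` is `O(∏ ‖ωᵢ‖_∞ · η ^ (j - 2))`, uniformly in the
triangulation. As `j ≥ 3` and `η ≤ 1`, this is `O(η)`, and integration over `M`, whose volume is
finite, gives the `L²`-bound (`SmoothTriangulation.IsCommensurable.l2Norm_whitney_m_deRham_le`).

The power of the mesh comes from a count of degrees. By locality and canonicity, the value of `m_j`
on a `k`-simplex is the value of one universal multilinear operation on the cochains of the standard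
`k`-simplex, which has finitely many structure constants. As `m_j` has degree `2 - j`, only tuples
of faces whose dimensions add up to `k + j - 2` contribute. The integral of `ω` over a `d`-simplex
is `O(‖ω‖_∞ η ^ d)`, because commensurability bounds the differential of the affine parametrization
(`SmoothTriangulation.abs_deRham_le`). Hence `m_j (R ω₁, …, R ω_j)` takes values
`O(∏ ‖ωᵢ‖_∞ · η ^ (k + j - 2))` on `k`-simplices (`abs_m_le`).

The Whitney form of a `k`-simplex is a polynomial of degree `k` in the differentials `dμᵢ`, so it
remains to see that `|dμᵢ| = O(1 / η)` in the interiors of the `n`-simplices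
(`SmoothTriangulation.IsComparison.abs_dmu_le`). Let `A` be a linear map such that `‖A s - A t‖` is
the Euclidean metric commensurable with the geodesic distance on such a simplex. Its columns have
length `O(η)`, and fullness bounds `|det A|` from below by a multiple of `η ^ n`: compare the
Riemannian and Euclidean volumes as Hausdorff measures. By Cramer's rule and Hadamard's inequality
(`abs_apply_mul_abs_det_le`) the barycentric coordinates are Lipschitz with constant `O(1 / η)` for
this Euclidean metric, hence for the geodesic distance. A Lipschitz bound for the geodesic distance
bounds the differential in the Riemannian norm (`abs_apply_le_of_hasMFDerivAt`, and
`norm_apply_le_of_hasMFDerivAt` for maps into `M`), since to first order at a point the geodesic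
distance is the norm of the tangent space.
-/

noncomputable section

namespace WhitneyCochains

/-! ### Metric and infinitesimal Lipschitz constants on Riemannian manifolds -/

section Riemannian

variable {E : Type*} [NormedAddCommGroup E] [NormedSpace ℝ E]
  {M : Type*} [PseudoEMetricSpace M] [ChartedSpace E M] [IsManifold 𝓘(ℝ, E) 1 M]
  [RiemannianBundle (fun x : M => TangentSpace 𝓘(ℝ, E) x)]
  [IsContinuousRiemannianBundle E (fun x : M => TangentSpace 𝓘(ℝ, E) x)]
  [IsRiemannianManifold 𝓘(ℝ, E) M]

/-- Near `x`, the displacement in the preferred chart, measured in `T_x M`, exceeds the Riemannian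
distance by a factor arbitrarily close to `1`. -/
lemma eventually_enorm_symmL_sub_le (x : M) {r : ℝ} (hr : 1 < r) :
    ∀ᶠ y in 𝓝 x, ‖((trivializationAt E (TangentSpace 𝓘(ℝ, E)) x).symmL ℝ x)
      (extChartAt 𝓘(ℝ, E) x y - extChartAt 𝓘(ℝ, E) x x)‖ₑ ≤ ENNReal.ofReal r * edist x y := by
  have h1 := eventually_norm_symmL_trivializationAt_self_comp_lt E
    (fun x : M => TangentSpace 𝓘(ℝ, E) x) x hr
  set S : E →L[ℝ] TangentSpace 𝓘(ℝ, E) x :=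
    (trivializationAt E (TangentSpace 𝓘(ℝ, E)) x).symmL ℝ x with hS
  obtain ⟨c, c_pos, hc⟩ := EMetric.mem_nhds_iff.1
    (Filter.inter_mem h1 (chart_source_mem_nhds E x))
  filter_upwards [Metric.eball_mem_nhds x c_pos] with y hy
  have hr0 : ENNReal.ofReal r ≠ 0 := by simp; linarith
  -- Compare with the lengths of paths from `x` to `y` that are short enough to stay in the region
  -- where the trivialization distorts norms by a factor less than `r`.
  refine le_of_forall_gt_imp_ge_of_dense fun a ha => ?_
  have hxy : edist x y < min (a / ENNReal.ofReal r) c := by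
    refine lt_min ?_ (by simpa [edist_comm] using hy)
    rwa [ENNReal.lt_div_iff_mul_lt (Or.inl hr0) (Or.inl ENNReal.ofReal_ne_top), mul_comm]
  rw [IsRiemannianManifold.out (I := 𝓘(ℝ, E)) x y] at hxy
  obtain ⟨γ, hγ0, hγ1, hγ, hlen⟩ := Manifold.exists_lt_of_riemannianEDist_lt hxy
  have hmem : ∀ t ∈ Set.Icc (0 : ℝ) 1, γ t ∈ Metric.eball x c := by
    intro t ht
    rw [Metric.mem_eball, edist_comm, IsRiemannianManifold.out (I := 𝓘(ℝ, E)) x (γ t)]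
    calc _ ≤ Manifold.pathELength 𝓘(ℝ, E) γ 0 t :=
          Manifold.riemannianEDist_le_pathELength
            (hγ.mono (Set.Icc_subset_Icc le_rfl ht.2)) hγ0 rfl ht.1
      _ ≤ Manifold.pathELength 𝓘(ℝ, E) γ 0 1 := Manifold.pathELength_mono le_rfl ht.2
      _ < _ := hlen.trans_le (min_le_right _ _)
  have hcd : ContDiffOn ℝ 1 (extChartAt 𝓘(ℝ, E) x ∘ γ) (Set.Icc 0 1) := by
    rw [← contMDiffOn_iff_contDiffOn]
    exact contMDiffOn_extChartAt.comp (I' := 𝓘(ℝ, E)) (t := (chartAt E x).source) hγ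
      (fun t ht => (hc (hmem t ht)).2)
  have hSd : ContDiffOn ℝ 1 (fun t => S (extChartAt 𝓘(ℝ, E) x (γ t))) (Set.Icc 0 1) :=
    S.contDiff.comp_contDiffOn hcd
  have hmain := enorm_sub_le_lintegral_derivWithin_Icc_of_contDiffOn_Icc hSd zero_le_one
  simp only [hγ0, hγ1] at hmain
  rw [map_sub]
  refine hmain.trans ?_
  have hbound : ∫⁻ t in Set.Icc (0 : ℝ) 1,
      ‖derivWithin (fun t => S (extChartAt 𝓘(ℝ, E) x (γ t))) (Set.Icc 0 1) t‖ₑ ≤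
      ∫⁻ t in Set.Icc (0 : ℝ) 1, ENNReal.ofReal r *
        ‖mfderivWithin 𝓘(ℝ, ℝ) 𝓘(ℝ, E) γ (Set.Icc 0 1) t 1‖ₑ := by
    refine setLIntegral_mono' measurableSet_Icc fun t ht => ?_
    have hu : UniqueDiffWithinAt ℝ (Set.Icc (0 : ℝ) 1) t := uniqueDiffOn_Icc zero_lt_one t ht
    have e1 : derivWithin (fun t => S (extChartAt 𝓘(ℝ, E) x (γ t))) (Set.Icc 0 1) t =
        S (derivWithin (extChartAt 𝓘(ℝ, E) x ∘ γ) (Set.Icc 0 1) t) := by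
      have hd := ((hcd.differentiableOn one_ne_zero) t ht).hasDerivWithinAt
      exact (S.hasFDerivAt.comp_hasDerivWithinAt t hd).derivWithin hu
    have e2 : mfderivWithin 𝓘(ℝ, ℝ) 𝓘(ℝ, E) (extChartAt 𝓘(ℝ, E) x ∘ γ) (Set.Icc 0 1) t =
        (mfderiv 𝓘(ℝ, E) 𝓘(ℝ, E) (extChartAt 𝓘(ℝ, E) x) (γ t)) ∘L
          (mfderivWithin 𝓘(ℝ, ℝ) 𝓘(ℝ, E) γ (Set.Icc 0 1) t) := by
      apply mfderiv_comp_mfderivWithin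
      · exact mdifferentiableAt_extChartAt (hc (hmem t ht)).2
      · exact hγ.mdifferentiableOn one_ne_zero _ ht
      · rwa [uniqueMDiffWithinAt_iff_uniqueDiffWithinAt]
    have e3 : derivWithin (extChartAt 𝓘(ℝ, E) x ∘ γ) (Set.Icc 0 1) t =
        (trivializationAt E (TangentSpace 𝓘(ℝ, E)) x).continuousLinearMapAt ℝ (γ t)
          (mfderivWithin 𝓘(ℝ, ℝ) 𝓘(ℝ, E) γ (Set.Icc 0 1) t 1) := by
      rw [TangentBundle.continuousLinearMapAt_trivializationAt (hc (hmem t ht)).2,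
        ← fderivWithin_derivWithin, ← mfderivWithin_eq_fderivWithin]
      exact congr($e2 1)
    rw [e1, e3]
    exact ContinuousLinearMap.le_of_opENorm_le (f := S ∘L
      (trivializationAt E (TangentSpace 𝓘(ℝ, E)) x).continuousLinearMapAt ℝ (γ t))
      (by rw [← ofReal_norm]; exact ENNReal.ofReal_le_ofReal (hc (hmem t ht)).1.le) _
  refine hbound.trans ?_
  rw [lintegral_const_mul' _ _ ENNReal.ofReal_ne_top,
    ← Manifold.pathELength_eq_lintegral_mfderivWithin_Icc]
  have := (hlen.trans_le (min_le_left _ _)).le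
  calc _ ≤ ENNReal.ofReal r * (a / ENNReal.ofReal r) := by gcongr
    _ ≤ a := ENNReal.mul_div_le

/-- A short coordinate segment in the direction `u` is a path of length at most `r` times the norm
of `u` times its coordinate length, for any given `r > 1`. -/
lemma eventually_edist_extChartAt_symm_le (x : M) (u : TangentSpace 𝓘(ℝ, E) x) (w : E)
    (hw : w = mfderiv 𝓘(ℝ, E) 𝓘(ℝ, E) (extChartAt 𝓘(ℝ, E) x) x u) {r : ℝ} (hr : 1 < r) :
    ∀ᶠ s in 𝓝[>] (0 : ℝ),
      edist ((extChartAt 𝓘(ℝ, E) x).symm (extChartAt 𝓘(ℝ, E) x x + s • w)) x ≤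
      ENNReal.ofReal (s * (r * ‖u‖)) := by
  have h1 := eventually_norm_symmL_trivializationAt_comp_self_lt E
    (fun x : M => TangentSpace 𝓘(ℝ, E) x) x hr
  set φ := extChartAt 𝓘(ℝ, E) x with hφ
  have hx : x ∈ (chartAt E x).source := mem_chart_source E x
  have hwu : w = (trivializationAt E (TangentSpace 𝓘(ℝ, E)) x).continuousLinearMapAt ℝ x u := by
    rw [hw, hφ, TangentBundle.continuousLinearMapAt_trivializationAt hx]
    rfl
  have hcont : ContinuousAt (fun s : ℝ => φ x + s • w) 0 := by fun_prop
  have h2 : ∀ᶠ z in 𝓝 (φ x), z ∈ φ.target ∧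
      ‖((trivializationAt E (TangentSpace 𝓘(ℝ, E)) x).symmL ℝ (φ.symm z))
      ∘L ((trivializationAt E (TangentSpace 𝓘(ℝ, E)) x).continuousLinearMapAt ℝ x)‖ < r := by
    refine Filter.inter_mem (extChartAt_target_mem_nhds x) ?_
    have hc : Filter.Tendsto φ.symm (𝓝 (φ x)) (𝓝 x) := by
      have := continuousAt_extChartAt_symm (I := 𝓘(ℝ, E)) x
      rwa [ContinuousAt, extChartAt_to_inv] at this
    exact hc.eventually h1
  have h3 : ∀ᶠ s in 𝓝 (0 : ℝ), φ x + s • w ∈ φ.target ∧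
      ‖((trivializationAt E (TangentSpace 𝓘(ℝ, E)) x).symmL ℝ (φ.symm (φ x + s • w)))
      ∘L ((trivializationAt E (TangentSpace 𝓘(ℝ, E)) x).continuousLinearMapAt ℝ x)‖ < r := by
    rw [ContinuousAt, zero_smul, add_zero] at hcont
    exact hcont.eventually h2
  obtain ⟨ε, hε, hball⟩ := Metric.eventually_nhds_iff.1 h3
  filter_upwards [Ioo_mem_nhdsGT hε] with s hs
  have hin : ∀ t ∈ Set.Icc 0 s, dist t 0 < ε := by
    intro t ht
    rw [Real.dist_0_eq_abs, abs_of_nonneg ht.1]; exact ht.2.trans_lt hs.2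
  have hηd : ∀ t : ℝ, HasFDerivAt (fun s : ℝ => φ x + s • w)
      ((ContinuousLinearMap.id ℝ ℝ).smulRight w) t := fun t =>
    ((hasFDerivAt_id t).smul_const w).const_add _
  have hη : ContMDiffOn 𝓘(ℝ, ℝ) 𝓘(ℝ, E) 1 (fun s : ℝ => φ x + s • w) (Set.Icc 0 s) := by
    rw [contMDiffOn_iff_contDiffOn]; fun_prop
  set γ : ℝ → M := φ.symm ∘ fun t : ℝ => φ x + t • w with hγ
  have hγs : ContMDiffOn 𝓘(ℝ, ℝ) 𝓘(ℝ, E) 1 γ (Set.Icc 0 s) :=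
    (contMDiffOn_extChartAt_symm x).comp hη fun t ht => (hball (hin t ht)).1
  have hle : edist x (γ s) ≤ Manifold.pathELength 𝓘(ℝ, E) γ 0 s := by
    rw [IsRiemannianManifold.out (I := 𝓘(ℝ, E)) x (γ s)]
    refine Manifold.riemannianEDist_le_pathELength hγs ?_ rfl hs.1.le
    simp [hγ, hφ]
  rw [edist_comm]
  refine hle.trans ?_
  rw [Manifold.pathELength_eq_lintegral_mfderivWithin_Icc]
  have hb : ∀ t ∈ Set.Icc 0 s, ‖mfderivWithin 𝓘(ℝ, ℝ) 𝓘(ℝ, E) γ (Set.Icc 0 s) t 1‖ₑ ≤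
      ENNReal.ofReal (r * ‖u‖) := by
    intro t ht
    obtain ⟨ht1, ht2⟩ := hball (hin t ht)
    have hu : UniqueDiffWithinAt ℝ (Set.Icc (0 : ℝ) s) t := uniqueDiffOn_Icc hs.1 t ht
    have e1 : mfderivWithin 𝓘(ℝ, ℝ) 𝓘(ℝ, E) γ (Set.Icc 0 s) t =
        (mfderivWithin 𝓘(ℝ, E) 𝓘(ℝ, E) φ.symm (Set.range 𝓘(ℝ, E)) (φ x + t • w)) ∘L
        (mfderivWithin 𝓘(ℝ, ℝ) 𝓘(ℝ, E) (fun s : ℝ => φ x + s • w) (Set.Icc 0 s) t) := by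
      apply mfderivWithin_comp
      · exact mdifferentiableWithinAt_extChartAt_symm ht1
      · exact hη.mdifferentiableOn one_ne_zero t ht
      · intro z _; simp
      · rwa [uniqueMDiffWithinAt_iff_uniqueDiffWithinAt]
    have e2 : (mfderivWithin 𝓘(ℝ, ℝ) 𝓘(ℝ, E) (fun s : ℝ => φ x + s • w) (Set.Icc 0 s) t) 1 = w := by
      rw [mfderivWithin_eq_fderivWithin, (hηd t).hasFDerivWithinAt.fderivWithin hu]
      exact one_smul ℝ w
    have hsrc : γ t ∈ (chartAt E x).source := by
      have := φ.map_target ht1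
      rwa [hφ, extChartAt_source] at this
    have e3 := TangentBundle.symmL_trivializationAt (I := 𝓘(ℝ, E)) hsrc
    have e4 : extChartAt 𝓘(ℝ, E) x (γ t) = φ x + t • w := φ.right_inv ht1
    rw [e4] at e3
    have e5 : mfderivWithin 𝓘(ℝ, ℝ) 𝓘(ℝ, E) γ (Set.Icc 0 s) t 1 =
        (trivializationAt E (TangentSpace 𝓘(ℝ, E)) x).symmL ℝ (γ t)
          ((trivializationAt E (TangentSpace 𝓘(ℝ, E)) x).continuousLinearMapAt ℝ x u) := by
      rw [← hwu, e3]
      have h6 : mfderivWithin 𝓘(ℝ, ℝ) 𝓘(ℝ, E) γ (Set.Icc 0 s) t 1 =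
          (mfderivWithin 𝓘(ℝ, E) 𝓘(ℝ, E) φ.symm (Set.range 𝓘(ℝ, E)) (φ x + t • w))
          (mfderivWithin 𝓘(ℝ, ℝ) 𝓘(ℝ, E) (fun s : ℝ => φ x + s • w) (Set.Icc 0 s) t 1) :=
        congr($e1 1)
      rw [h6]
      exact congrArg _ e2
    rw [e5, ← ofReal_norm]
    refine ENNReal.ofReal_le_ofReal ?_
    exact ContinuousLinearMap.le_of_opNorm_le
      (((trivializationAt E (TangentSpace 𝓘(ℝ, E)) x).symmL ℝ (γ t))
      ∘L ((trivializationAt E (TangentSpace 𝓘(ℝ, E)) x).continuousLinearMapAt ℝ x)) ht2.le u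
  calc _ ≤ ∫⁻ t in Set.Icc 0 s, ENNReal.ofReal (r * ‖u‖) := setLIntegral_mono' measurableSet_Icc hb
    _ = _ := by
      rw [setLIntegral_const, Real.volume_Icc, sub_zero, mul_comm, ENNReal.ofReal_mul hs.1.le]

/-- A function that is `L`-Lipschitz at a point for the Riemannian distance has differential of norm
at most `L` there. -/
lemma abs_apply_le_of_hasMFDerivAt {f : M → ℝ} {x : M} {D : TangentSpace 𝓘(ℝ, E) x →L[ℝ] ℝ}
    (hD : HasMFDerivAt 𝓘(ℝ, E) 𝓘(ℝ, ℝ) f x D) {L : ℝ} (hL : 0 ≤ L)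
    (hf : ∀ᶠ y in 𝓝 x, ENNReal.ofReal |f y - f x| ≤ ENNReal.ofReal L * edist y x)
    (u : TangentSpace 𝓘(ℝ, E) x) : |D u| ≤ L * ‖u‖ := by
  set φ := extChartAt 𝓘(ℝ, E) x with hφ
  obtain ⟨w, hwu⟩ : ∃ w : E, w = u := ⟨u, rfl⟩
  have hw : w = mfderiv 𝓘(ℝ, E) 𝓘(ℝ, E) (extChartAt 𝓘(ℝ, E) x) x u := by
    rw [hwu, mfderiv_extChartAt_self]; rfl
  have hfx : φ.symm (φ x) = x := by rw [hφ, extChartAt_to_inv]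
  have hd : HasFDerivAt (f ∘ φ.symm) (D : E →L[ℝ] ℝ) (φ x) := by
    have h := hD.2
    rw [modelWithCornersSelf_coe, Set.range_id] at h
    exact h.hasFDerivAt Filter.univ_mem
  have hline : HasDerivAt (fun s : ℝ => f (φ.symm (φ x + s • w))) (D u) 0 := by
    have h1 : HasDerivAt (fun s : ℝ => φ x + s • w) w 0 := by
      simpa using ((hasDerivAt_id (0 : ℝ)).smul_const w).const_add (φ x)
    have h2 : HasFDerivAt (f ∘ φ.symm) (D : E →L[ℝ] ℝ) (φ x + (0 : ℝ) • w) := by simpa using hd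
    have h3 := h2.comp_hasDerivAt (0 : ℝ) h1
    rw [hwu] at h3
    rw [hwu]
    exact h3
  have hγ : Filter.Tendsto (fun s : ℝ => φ.symm (φ x + s • w)) (𝓝[>] 0) (𝓝 x) := by
    have hc : ContinuousAt (fun s : ℝ => φ x + s • w) 0 := by fun_prop
    rw [ContinuousAt, zero_smul, add_zero] at hc
    have h4 := continuousAt_extChartAt_symm (I := 𝓘(ℝ, E)) x
    rw [ContinuousAt, extChartAt_to_inv] at h4
    exact (h4.comp hc).mono_left nhdsWithin_le_nhds
  have key : ∀ r : ℝ, 1 < r → |D u| ≤ L * (r * ‖u‖) := by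
    intro r hr
    refine le_of_tendsto hline.tendsto_slope_zero_right.abs ?_
    filter_upwards [eventually_edist_extChartAt_symm_le x u w hw hr, hγ.eventually hf,
      self_mem_nhdsWithin] with s hs1 hs2 hs3
    have hs3 : 0 < s := hs3
    have h5 := hs2.trans (mul_le_mul_right hs1 _)
    rw [← ENNReal.ofReal_mul hL, ENNReal.ofReal_le_ofReal_iff (by positivity)] at h5
    simp only [zero_add, zero_smul, add_zero, smul_eq_mul, hfx]
    rw [abs_mul, abs_inv, abs_of_pos hs3, inv_mul_le_iff₀ hs3]
    linarith
  have hlim : Filter.Tendsto (fun r : ℝ => L * (r * ‖u‖)) (𝓝[>] 1) (𝓝 (L * (1 * ‖u‖))) :=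
    (Continuous.tendsto (by fun_prop) 1).mono_left nhdsWithin_le_nhds
  rw [one_mul] at hlim
  exact ge_of_tendsto hlim (by filter_upwards [self_mem_nhdsWithin] with r hr using key r hr)

/-- The speed of a map into a Riemannian manifold is bounded by its metric speed. -/
lemma norm_apply_le_of_hasMFDerivAt {F : Type*} [NormedAddCommGroup F] [NormedSpace ℝ F]
    {f : F → M} {t : F} {D : F →L[ℝ] TangentSpace 𝓘(ℝ, E) (f t)}
    (hD : HasMFDerivAt 𝓘(ℝ, F) 𝓘(ℝ, E) f t D) (u : F) {L : ℝ} (hL : 0 ≤ L)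
    (hf : ∀ᶠ s in 𝓝[>] (0 : ℝ), edist (f t) (f (t + s • u)) ≤ ENNReal.ofReal (s * L)) :
    ‖D u‖ ≤ L := by
  set φ := extChartAt 𝓘(ℝ, E) (f t) with hφ
  set S : E →L[ℝ] TangentSpace 𝓘(ℝ, E) (f t) :=
    (trivializationAt E (TangentSpace 𝓘(ℝ, E)) (f t)).symmL ℝ (f t) with hS
  have hSD : ∀ v : TangentSpace 𝓘(ℝ, E) (f t), ∀ w : E, w = v → S w = v := by
    intro v w hw
    have h1 := (trivializationAt E (TangentSpace 𝓘(ℝ, E))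
      (f t)).symmL_continuousLinearMapAt (R := ℝ) (FiberBundle.mem_baseSet_trivializationAt' (f t)) v
    rw [TangentBundle.continuousLinearMapAt_trivializationAt (mem_chart_source E (f t)),
      mfderiv_extChartAt_self] at h1
    rw [hw]
    exact h1
  have hd : HasFDerivAt (φ ∘ f) (D : F →L[ℝ] E) t := by
    have h := hD.2
    rw [modelWithCornersSelf_coe, Set.range_id] at h
    exact h.hasFDerivAt Filter.univ_mem
  have hline : HasDerivAt (fun s : ℝ => S (φ (f (t + s • u)))) (D u) 0 := by
    have h1 : HasDerivAt (fun s : ℝ => t + s • u) u 0 := by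
      simpa using ((hasDerivAt_id (0 : ℝ)).smul_const u).const_add t
    have h2 : HasFDerivAt (φ ∘ f) (D : F →L[ℝ] E) (t + (0 : ℝ) • u) := by simpa using hd
    have h3 := S.hasFDerivAt.comp_hasDerivAt (0 : ℝ) (h2.comp_hasDerivAt (0 : ℝ) h1)
    have h4 : S ((D : F →L[ℝ] E) u) = D u := hSD (D u) _ rfl
    rw [← h4]
    exact h3
  have hγ : Filter.Tendsto (fun s : ℝ => f (t + s • u)) (𝓝[>] 0) (𝓝 (f t)) := by
    have hc : ContinuousAt (fun s : ℝ => t + s • u) 0 := by fun_prop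
    rw [ContinuousAt, zero_smul, add_zero] at hc
    exact (hD.1.tendsto.comp hc).mono_left nhdsWithin_le_nhds
  have key : ∀ r : ℝ, 1 < r → ‖D u‖ ≤ r * L := by
    intro r hr
    refine le_of_tendsto hline.tendsto_slope_zero_right.norm ?_
    filter_upwards [hγ.eventually (eventually_enorm_symmL_sub_le (E := E) (f t) hr), hf,
      self_mem_nhdsWithin] with s hs1 hs2 hs3
    have hs3 : 0 < s := hs3
    have hr0 : 0 < r := zero_lt_one.trans hr
    have h5 := hs1.trans (mul_le_mul_right hs2 _)
    rw [← ENNReal.ofReal_mul hr0.le, ← ofReal_norm,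
      ENNReal.ofReal_le_ofReal_iff (by positivity)] at h5
    have h6 : ‖S (φ (f (t + s • u))) - S (φ (f t))‖ ≤ r * (s * L) := by
      rw [← S.map_sub]; exact h5
    simp only [zero_add, zero_smul, add_zero]
    rw [norm_smul, norm_inv, Real.norm_of_nonneg hs3.le, inv_mul_le_iff₀ hs3]
    refine h6.trans (by linarith)
  have hlim : Filter.Tendsto (fun r : ℝ => r * L) (𝓝[>] 1) (𝓝 (1 * L)) :=
    (Continuous.tendsto (by fun_prop) 1).mono_left nhdsWithin_le_nhds
  rw [one_mul] at hlim
  exact ge_of_tendsto hlim (by filter_upwards [self_mem_nhdsWithin] with r hr using key r hr)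

end Riemannian

/-! ### The norm on the exterior algebra -/

section Exterior

variable {V : Type*} [NormedAddCommGroup V] [InnerProductSpace ℝ V] [FiniteDimensional ℝ V]

lemma formNorm_nonneg (a : ∀ k : ℕ, V [⋀^Fin k]→ₗ[ℝ] ℝ) : 0 ≤ formNorm a := Real.sqrt_nonneg _

/-- The tuple of basis vectors need not be increasing: alternation reduces the estimate to that
case. -/
lemma abs_apply_stdOrthonormalBasis_le_formNorm (a : ∀ k : ℕ, V [⋀^Fin k]→ₗ[ℝ] ℝ) {k : ℕ}
    (i : Fin k → Fin (Module.finrank ℝ V)) :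
    |a k fun j => stdOrthonormalBasis ℝ V (i j)| ≤ formNorm a := by
  by_cases hi : Function.Injective i
  swap
  · have h : a k (fun j => stdOrthonormalBasis ℝ V (i j)) = 0 := by
      refine AlternatingMap.map_eq_zero_of_not_injective _ _ fun h => hi ?_
      exact Function.Injective.of_comp (f := stdOrthonormalBasis ℝ V) h
    rw [h, abs_zero]
    exact formNorm_nonneg a
  have hmono : StrictMono (i ∘ Tuple.sort i) :=
    (Tuple.monotone_sort i).strictMono_of_injective (hi.comp (Tuple.sort i).injective)
  have hperm := (a k).map_perm (fun j => stdOrthonormalBasis ℝ V (i j)) (Tuple.sort i)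
  have habs : |a k fun j => stdOrthonormalBasis ℝ V (i j)| =
      |a k fun j => stdOrthonormalBasis ℝ V (i (Tuple.sort i j))| := by
    have h : (fun j => stdOrthonormalBasis ℝ V (i (Tuple.sort i j))) =
      (fun j => stdOrthonormalBasis ℝ V (i j)) ∘ Tuple.sort i := rfl
    rw [h, hperm]
    rcases Int.units_eq_one_or (Equiv.Perm.sign (Tuple.sort i)) with h | h <;> simp [h]
  have hk : k ≤ Module.finrank ℝ V := by
    simpa using Fintype.card_le_of_injective i hi
  rw [habs]
  refine Real.abs_le_sqrt ?_
  refine le_trans ?_ (Finset.single_le_sum (f := fun k => ∑ i : Fin k ↪o Fin (Module.finrank ℝ V),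
    (a k fun j => stdOrthonormalBasis ℝ V (i j)) ^ 2)
    (fun _ _ => Finset.sum_nonneg fun _ _ => sq_nonneg _) (Finset.mem_range_succ_iff.2 hk))
  exact Finset.single_le_sum (f := fun i : Fin k ↪o Fin (Module.finrank ℝ V) =>
    (a k fun j => stdOrthonormalBasis ℝ V (i j)) ^ 2) (fun _ _ => sq_nonneg _)
    (Finset.mem_univ (OrderEmbedding.ofStrictMono _ hmono))

lemma abs_apply_le_formNorm (a : ∀ k : ℕ, V [⋀^Fin k]→ₗ[ℝ] ℝ) {k : ℕ} {u : Fin k → V} {X : ℝ}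
    (hu : ∀ i, ‖u i‖ ≤ X) :
    |a k u| ≤ (Module.finrank ℝ V : ℝ) ^ k * X ^ k * formNorm a := by
  set e := stdOrthonormalBasis ℝ V
  have hexp : u = fun i => ∑ l, inner ℝ (e l) (u i) • e l :=
    funext fun i => (e.sum_repr' (u i)).symm
  have hsum : a k u = ∑ r : Fin k → Fin (Module.finrank ℝ V),
      (∏ i, inner ℝ (e (r i)) (u i)) * a k (fun i => e (r i)) := by
    conv_lhs => rw [hexp]
    rw [← AlternatingMap.coe_multilinearMap, MultilinearMap.map_sum]
    refine Finset.sum_congr rfl fun r _ => ?_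
    rw [MultilinearMap.map_smul_univ, smul_eq_mul]
  rw [hsum]
  refine (Finset.abs_sum_le_sum_abs _ _).trans ?_
  have hterm : ∀ r ∈ (Finset.univ : Finset (Fin k → Fin (Module.finrank ℝ V))),
      |(∏ i, inner ℝ (e (r i)) (u i)) * a k (fun i => e (r i))| ≤ X ^ k * formNorm a := by
    intro r _
    rw [abs_mul, Finset.abs_prod]
    have h1 : ∏ i, |inner ℝ (e (r i)) (u i)| ≤ X ^ k := by
      refine (Finset.prod_le_prod (fun _ _ => abs_nonneg _) (g := fun _ => X) fun i _ => ?_).trans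
        (by simp)
      refine (abs_real_inner_le_norm _ _).trans ?_
      rw [e.norm_eq_one, one_mul]
      exact hu i
    exact mul_le_mul h1 (abs_apply_stdOrthonormalBasis_le_formNorm a r) (abs_nonneg _)
      ((Finset.prod_nonneg fun _ _ => abs_nonneg _).trans h1)
  refine (Finset.sum_le_card_nsmul _ _ _ hterm).trans (le_of_eq ?_)
  simp [mul_assoc]

lemma formNorm_le {a : ∀ k : ℕ, V [⋀^Fin k]→ₗ[ℝ] ℝ} {n : ℕ} (hn : Module.finrank ℝ V = n) {C : ℝ}
    (hC : 0 ≤ C) (h : ∀ k ≤ n, ∀ u : Fin k → V, (∀ i, ‖u i‖ = 1) → |a k u| ≤ C) :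
    formNorm a ≤ √(∑ k ∈ Finset.range (n + 1), Fintype.card (Fin k ↪o Fin n)) * C := by
  subst hn
  rw [← Real.sqrt_sq hC, ← Real.sqrt_mul (by positivity), formNorm]
  refine Real.sqrt_le_sqrt ?_
  rw [Finset.sum_mul]
  refine Finset.sum_le_sum fun k hk => ?_
  refine (Finset.sum_le_card_nsmul _ _ (C ^ 2) fun i _ => ?_).trans (by simp)
  rw [← sq_abs]
  have := h k (Finset.mem_range_succ_iff.1 hk) (fun j => stdOrthonormalBasis ℝ V (i j))
    (fun j => (stdOrthonormalBasis ℝ V).norm_eq_one _)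
  gcongr

end Exterior

/-! ### Whitney expressions -/

section Whitney

variable {V : Type*} [AddCommGroup V] [Module ℝ V]

lemma wedgeCovectors_apply {k : ℕ} (l : Fin k → (V →ₗ[ℝ] ℝ)) (u : Fin k → V) :
    wedgeCovectors l u = (Matrix.of fun i j => l j (u i)).det := rfl

lemma abs_whitneyExpr_apply_le {k : ℕ} {mu : Fin (k + 1) → ℝ} {dmu : Fin (k + 1) → (V →ₗ[ℝ] ℝ)}
    {u : Fin k → V} {X : ℝ} (hmu : ∀ i, |mu i| ≤ 1) (hdmu : ∀ i j, |dmu i (u j)| ≤ X) :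
    |whitneyExpr mu dmu u| ≤ k.factorial * ((k + 1) * (k.factorial * X ^ k)) := by
  rw [whitneyExpr, AlternatingMap.smul_apply, smul_eq_mul, abs_mul,
    Nat.abs_cast]
  refine mul_le_mul_of_nonneg_left ?_ (Nat.cast_nonneg _)
  have hsum : (∑ i : Fin (k + 1), ((-1 : ℝ) ^ (i : ℕ) * mu i) •
      wedgeCovectors fun j => dmu (i.succAbove j)) u = ∑ i : Fin (k + 1),
        (((-1 : ℝ) ^ (i : ℕ) * mu i) • wedgeCovectors fun j => dmu (i.succAbove j)) u :=
    map_sum ((AddMonoidHom.mk' (fun f : V [⋀^Fin k]→ₗ[ℝ] ℝ => f u) fun _ _ => rfl)) _ _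
  rw [hsum]
  refine (Finset.abs_sum_le_sum_abs _ _).trans ?_
  refine (Finset.sum_le_card_nsmul _ _ (k.factorial * X ^ k) fun i _ => ?_).trans (by simp)
  rw [AlternatingMap.smul_apply, smul_eq_mul, abs_mul, abs_mul, abs_pow, abs_neg, abs_one, one_pow,
    one_mul, wedgeCovectors_apply]
  have h := Matrix.det_le (abv := AbsoluteValue.abs)
    (A := Matrix.of fun i' j => dmu (i.succAbove j) (u i')) (x := X) fun i' j => hdmu _ _
  rw [Fintype.card_fin, nsmul_eq_mul] at h
  exact (mul_le_of_le_one_left (abs_nonneg _) (hmu i)).trans h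

/-- Every summand of the Whitney expression contains either `μᵢ₀` or `dμᵢ₀`. -/
lemma whitneyExpr_eq_zero {k : ℕ} {mu : Fin (k + 1) → ℝ} {dmu : Fin (k + 1) → (V →ₗ[ℝ] ℝ)}
    {i₀ : Fin (k + 1)} (hmu : mu i₀ = 0) (hdmu : dmu i₀ = 0) : whitneyExpr mu dmu = 0 := by
  rw [whitneyExpr, Finset.sum_eq_zero, smul_zero]
  intro i _
  by_cases hi : i = i₀
  · rw [hi, hmu, mul_zero, zero_smul]
  · obtain ⟨j, hj⟩ := Fin.exists_succAbove_eq (Ne.symm hi)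
    have : wedgeCovectors (fun j => dmu (i.succAbove j)) = 0 := by
      ext u
      rw [wedgeCovectors_apply]
      refine Matrix.det_eq_zero_of_column_eq_zero j fun i' => ?_
      simp [hj, hdmu]
    rw [this, smul_zero]

end Whitney

/-! ### Pointwise norm and supremum norm of forms -/

section SupNorm

variable {n : ℕ} {M : Type*} [EMetricSpace M] [ChartedSpace (EuclideanSpace ℝ (Fin n)) M]
  [IsManifold (𝓡 n) 1 M]
  [RiemannianBundle (fun x : M => TangentSpace (𝓡 n) x)]
  [IsContinuousRiemannianBundle (EuclideanSpace ℝ (Fin n)) (fun x : M => TangentSpace (𝓡 n) x)]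

omit [IsManifold (𝓡 n) 1 M] [IsContinuousRiemannianBundle (EuclideanSpace ℝ (Fin n))
  (fun x : M => TangentSpace (𝓡 n) x)] in
/-- The module structure is the one underlying the Riemannian inner product; instance search would
find the one of the model space instead. -/
lemma finrank_tangentSpace (p : M) :
    @Module.finrank ℝ (TangentSpace (𝓡 n) p) _
      SeminormedAddCommGroup.toAddCommGroup.toAddCommMonoid NormedSpace.toModule = n :=
  finrank_euclideanSpace_fin

omit [IsContinuousRiemannianBundle (EuclideanSpace ℝ (Fin n))
  (fun x : M => TangentSpace (𝓡 n) x)] [RiemannianBundle (fun x : M => TangentSpace (𝓡 n) x)] in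
lemma mfderiv_extChartAt_symm_continuousLinearMapAt {p₀ : M} {y : EuclideanSpace ℝ (Fin n)}
    (hy : y ∈ (extChartAt (𝓡 n) p₀).target)
    (u : TangentSpace (𝓡 n) ((extChartAt (𝓡 n) p₀).symm y)) :
    mfderiv 𝓘(ℝ, EuclideanSpace ℝ (Fin n)) (𝓡 n) (extChartAt (𝓡 n) p₀).symm y
      ((trivializationAt (EuclideanSpace ℝ (Fin n)) (TangentSpace (𝓡 n)) p₀).continuousLinearMapAt ℝ
      ((extChartAt (𝓡 n) p₀).symm y) u) = u := by
  have hp : (extChartAt (𝓡 n) p₀).symm y ∈ (chartAt (EuclideanSpace ℝ (Fin n)) p₀).source := by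
    have := (extChartAt (𝓡 n) p₀).map_target hy
    rwa [extChartAt_source] at this
  have h3 := mfderivWithin_extChartAt_symm_comp_mfderiv_extChartAt (I := 𝓡 n) (x := p₀) (y := y) hy
  rw [modelWithCornersSelf_coe, Set.range_id, mfderivWithin_univ] at h3
  have h5 := TangentBundle.continuousLinearMapAt_trivializationAt (I := 𝓡 n) hp
  rw [h5]
  exact congr($h3 u)

omit [IsManifold (𝓡 n) 1 M] [IsContinuousRiemannianBundle (EuclideanSpace ℝ (Fin n))
  (fun x : M => TangentSpace (𝓡 n) x)] in
lemma pointwiseNorm_nonneg (p : M) (a : ∀ k : ℕ, TangentSpace (𝓡 n) p [⋀^Fin k]→ₗ[ℝ] ℝ) :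
    0 ≤ pointwiseNorm p a := by
  unfold pointwiseNorm
  exact formNorm_nonneg (V := TangentSpace (𝓡 n) p) a

omit [IsManifold (𝓡 n) 1 M] [IsContinuousRiemannianBundle (EuclideanSpace ℝ (Fin n))
  (fun x : M => TangentSpace (𝓡 n) x)] in
lemma pointwiseNorm_le {p : M} {a : ∀ k : ℕ, TangentSpace (𝓡 n) p [⋀^Fin k]→ₗ[ℝ] ℝ} {C : ℝ}
    (hC : 0 ≤ C)
    (h : ∀ k ≤ n, ∀ u : Fin k → TangentSpace (𝓡 n) p, (∀ i, ‖u i‖ = 1) → |a k u| ≤ C) :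
    pointwiseNorm p a ≤ √(∑ k ∈ Finset.range (n + 1), Fintype.card (Fin k ↪o Fin n)) * C := by
  unfold pointwiseNorm
  exact formNorm_le (V := TangentSpace (𝓡 n) p) (finrank_tangentSpace p) hC h

omit [IsManifold (𝓡 n) 1 M] [IsContinuousRiemannianBundle (EuclideanSpace ℝ (Fin n))
  (fun x : M => TangentSpace (𝓡 n) x)] in
lemma abs_apply_le_pointwiseNorm {p : M} (a : ∀ k : ℕ, TangentSpace (𝓡 n) p [⋀^Fin k]→ₗ[ℝ] ℝ)
    {k : ℕ} {u : Fin k → TangentSpace (𝓡 n) p} {X : ℝ} (hu : ∀ i, ‖u i‖ ≤ X) :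
    |a k u| ≤ (n : ℝ) ^ k * X ^ k * pointwiseNorm p a := by
  have h := abs_apply_le_formNorm (V := TangentSpace (𝓡 n) p) a hu
  rw [finrank_tangentSpace p] at h
  exact h

/-- In the preferred chart at `p₀`, unit tangent vectors near `p₀` have bounded coordinates and the
coordinate expression of the form is continuous. -/
lemma SmoothForm.exists_eventually_pointwiseNorm_le (w : SmoothForm n M) (p₀ : M) :
    ∃ C : ℝ, ∀ᶠ p in 𝓝 p₀, pointwiseNorm p (fun k => (w.val p k).toAlternatingMap) ≤ C := by
  set φ := extChartAt (𝓡 n) p₀ with hφ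
  obtain ⟨C, hC, hCe⟩ := eventually_norm_trivializationAt_lt (EuclideanSpace ℝ (Fin n))
    (fun x : M => TangentSpace (𝓡 n) x) p₀
  let f : ∀ k : ℕ, EuclideanSpace ℝ (Fin n) → EuclideanSpace ℝ (Fin n) [⋀^Fin k]→L[ℝ] ℝ :=
    fun k y => (w.val (φ.symm y) k).compContinuousLinearMap
      (mfderiv 𝓘(ℝ, EuclideanSpace ℝ (Fin n)) (𝓡 n) φ.symm y)
  have hf : ∀ k, ∀ᶠ p in 𝓝 p₀, ‖f k (φ p)‖ < ‖f k (φ p₀)‖ + 1 := by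
    intro k
    have h1 : ContinuousAt (f k) (φ p₀) :=
      (w.smooth k p₀).continuousOn.continuousAt (extChartAt_target_mem_nhds p₀)
    have h2 : ContinuousAt (fun p => ‖f k (φ p)‖) p₀ :=
      (ContinuousAt.comp (f := φ) h1 (continuousAt_extChartAt p₀)).norm
    exact h2.eventually_lt_const (lt_add_one _)
  have hall : ∀ᶠ p in 𝓝 p₀, ∀ k ∈ Finset.range (n + 1), ‖f k (φ p)‖ < ‖f k (φ p₀)‖ + 1 :=
    (Filter.eventually_all_finset _).2 fun k _ => hf k
  let B : ℝ := ∑ k ∈ Finset.range (n + 1), (‖f k (φ p₀)‖ + 1) * C ^ k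
  have hB : 0 ≤ B := Finset.sum_nonneg fun k _ => by positivity
  refine ⟨√(∑ k ∈ Finset.range (n + 1), Fintype.card (Fin k ↪o Fin n)) * B, ?_⟩
  filter_upwards [hCe, hall, chart_source_mem_nhds (EuclideanSpace ℝ (Fin n)) p₀] with p h1 h2 hp
  refine pointwiseNorm_le hB fun k hk u hu => ?_
  have hp' : p ∈ φ.source := by rwa [hφ, extChartAt_source]
  obtain ⟨y, hy, rfl⟩ : ∃ y ∈ φ.target, p = φ.symm y :=
    ⟨φ p, φ.map_source hp', (φ.left_inv hp').symm⟩
  let v : Fin k → EuclideanSpace ℝ (Fin n) := fun i =>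
    (trivializationAt (EuclideanSpace ℝ (Fin n)) (TangentSpace (𝓡 n)) p₀).continuousLinearMapAt ℝ
      (φ.symm y) (u i)
  have hv : ∀ i, ‖v i‖ ≤ C := fun i => by
    have := ContinuousLinearMap.le_of_opNorm_le _ h1.le (u i)
    rwa [hu i, mul_one] at this
  have hkey : w.val (φ.symm y) k u = f k y v :=
    congrArg (w.val (φ.symm y) k)
      (funext fun i => (mfderiv_extChartAt_symm_continuousLinearMapAt hy (u i)).symm)
  have h2k := h2 k (Finset.mem_range_succ_iff.2 hk)
  rw [φ.right_inv hy] at h2k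
  rw [ContinuousAlternatingMap.coe_toAlternatingMap, hkey, ← Real.norm_eq_abs]
  calc ‖f k y v‖ ≤ ‖f k y‖ * ∏ i, ‖v i‖ := (f k y).le_opNorm v
    _ ≤ (‖f k (φ p₀)‖ + 1) * C ^ k := by
        refine mul_le_mul h2k.le ?_ (Finset.prod_nonneg fun _ _ => norm_nonneg _) (by positivity)
        refine (Finset.prod_le_prod (fun _ _ => norm_nonneg _) fun i _ => hv i).trans (by simp)
    _ ≤ B := Finset.single_le_sum (f := fun k => (‖f k (φ p₀)‖ + 1) * C ^ k)
        (fun k _ => by positivity) (Finset.mem_range_succ_iff.2 hk)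

lemma SmoothForm.supNorm_ne_top [CompactSpace M] (w : SmoothForm n M) : w.supNorm ≠ ⊤ := by
  choose C hC using w.exists_eventually_pointwiseNorm_le
  obtain ⟨t, -, ht⟩ := isCompact_univ.elim_nhds_subcover _ fun p _ => hC p
  have h : w.supNorm ≤ ∑ p ∈ t, ENNReal.ofReal (C p) := by
    refine iSup_le fun p => ?_
    obtain ⟨q, hq, hpq⟩ := Set.mem_iUnion₂.1 (ht (Set.mem_univ p))
    exact (ENNReal.ofReal_le_ofReal hpq).trans
      (Finset.single_le_sum (f := fun p => ENNReal.ofReal (C p)) (fun _ _ => zero_le) hq)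
  exact ne_top_of_le_ne_top (by simp [ENNReal.sum_eq_top]) h

end SupNorm

/-! ### The standard simplex -/

section Corner

lemma convex_corner (k : ℕ) : Convex ℝ (corner k) := by
  intro s hs t ht a b ha hb hab
  refine ⟨fun i => ?_, ?_⟩
  · have h1 := hs.1 i
    have h2 := ht.1 i
    simp only [PiLp.add_apply, PiLp.smul_apply, smul_eq_mul]
    positivity
  · simp only [PiLp.add_apply, PiLp.smul_apply, smul_eq_mul, Finset.sum_add_distrib,
      ← Finset.mul_sum]
    calc _ ≤ a * 1 + b * 1 :=
          add_le_add (mul_le_mul_of_nonneg_left hs.2 ha) (mul_le_mul_of_nonneg_left ht.2 hb)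
      _ = 1 := by rw [mul_one, mul_one, hab]

lemma corner_subset_closedBall (k : ℕ) : corner k ⊆ Metric.closedBall 0 1 := by
  intro t ht
  rw [mem_closedBall_zero_iff, EuclideanSpace.norm_eq, ← Real.sqrt_one]
  refine Real.sqrt_le_sqrt ?_
  have hle : ∀ i, t i ≤ 1 := fun i =>
    (Finset.single_le_sum (f := fun i => t i) (fun i _ => ht.1 i) (Finset.mem_univ i)).trans ht.2
  refine le_trans (Finset.sum_le_sum fun i _ => ?_) ht.2
  rw [Real.norm_of_nonneg (ht.1 i), sq]
  exact mul_le_of_le_one_left (ht.1 i) (hle i)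

lemma volume_corner_lt_top (k : ℕ) : volume (corner k) < ⊤ :=
  (measure_mono (corner_subset_closedBall k)).trans_lt measure_closedBall_lt_top

lemma single_mem_corner {k : ℕ} (l : Fin k) : EuclideanSpace.single l (1 : ℝ) ∈ corner k := by
  refine ⟨fun i => ?_, ?_⟩
  · by_cases h : i = l <;> simp [h]
  · simp

end Corner

/-! ### Cramer's rule and Hadamard's inequality -/

section LinearAlgebra

variable {n : ℕ}

/-- Cramer's rule expresses `x i * det A` as the determinant of the columns of `A` with the `i`-th
one replaced by `A x`; Hadamard's inequality bounds this determinant. -/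
lemma abs_apply_mul_abs_det_le
    (A : EuclideanSpace ℝ (Fin n) →ₗ[ℝ] EuclideanSpace ℝ (Fin n)) {R : ℝ}
    (hR : ∀ l, ‖A (EuclideanSpace.single l 1)‖ ≤ R) (x : EuclideanSpace ℝ (Fin n)) (i : Fin n) :
    |x i| * |LinearMap.det A| ≤ ‖A x‖ * R ^ (n - 1) := by
  have : Fact (Module.finrank ℝ (EuclideanSpace ℝ (Fin n)) = n) := ⟨finrank_euclideanSpace_fin⟩
  set b := EuclideanSpace.basisFun (Fin n) ℝ
  set o := b.toBasis.orientation
  have hvol : o.volumeForm = b.toBasis.det := o.volumeForm_robust b rfl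
  set v : Fin n → EuclideanSpace ℝ (Fin n) := Function.update b.toBasis i x with hv
  have h1 : b.toBasis.det v = x i := by
    rw [Module.Basis.det_apply, hv, Module.Basis.toMatrix_update, Module.Basis.toMatrix_self,
      ← Matrix.cramer_apply, Matrix.cramer_one]
    simp [b]
  have h2 : b.toBasis.det (A ∘ v) = LinearMap.det A * x i := by
    rw [Module.Basis.det_comp, h1]
  have h3 := o.abs_volumeForm_apply_le (A ∘ v)
  rw [hvol, h2, abs_mul, mul_comm] at h3
  refine h3.trans ?_
  rw [hv, Function.comp_update, ← Finset.mul_prod_erase _ _ (Finset.mem_univ i),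
    Function.update_self]
  refine mul_le_mul_of_nonneg_left ?_ (norm_nonneg _)
  refine (Finset.prod_le_prod (g := fun _ => R) (fun _ _ => norm_nonneg _) fun l hl => ?_).trans ?_
  · rw [Function.update_of_ne (Finset.ne_of_mem_erase hl)]
    simpa [b] using hR l
  · simp

end LinearAlgebra

/-! ### Hausdorff measure of Lipschitz images -/

section Hausdorff

variable {X Y : Type*} [EMetricSpace X] [MeasurableSpace X] [BorelSpace X]
  [EMetricSpace Y] [MeasurableSpace Y] [BorelSpace Y]

lemma euclideanHausdorffMeasure_image_le {f : X → Y} {s : Set X} {K : ℝ≥0}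
    (hf : LipschitzOnWith K f s) (d : ℕ) : μHE[d] (f '' s) ≤ K ^ d * μHE[d] s := by
  rw [Measure.euclideanHausdorffMeasure_def, Measure.euclideanHausdorffMeasure_def,
    Measure.smul_apply, Measure.smul_apply, ENNReal.smul_def, ENNReal.smul_def, smul_eq_mul,
    smul_eq_mul]
  have h := hf.hausdorffMeasure_image_le (d := d) (Nat.cast_nonneg d)
  rw [ENNReal.rpow_natCast] at h
  calc _ ≤ _ := mul_le_mul_right h _
    _ = _ := by ring

end Hausdorff

/-! ### Barycentric coordinates and edges -/

section Simplex

variable {N : ℕ} {K : AbstractSimplicialComplex (Fin N)} {k : ℕ}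

lemma bary_apply_vertex (v : Simplex K k) (t : EuclideanSpace ℝ (Fin k)) (i : Fin (k + 1)) :
    bary v t (v.1 i) = (Fin.cons (1 - ∑ j, t j) (fun j => t j) : Fin (k + 1) → ℝ) i := by
  simp only [bary, Finset.sum_apply, Pi.smul_apply, smul_eq_mul]
  rw [Finset.sum_eq_single i]
  · simp
  · intro l _ hl
    have : v.1 i ≠ v.1 l := fun h => hl (v.1.injective h).symm
    simp [this]
  · simp

lemma bary_apply_of_notMem (v : Simplex K k) (t : EuclideanSpace ℝ (Fin k)) {a : Fin N}
    (ha : ∀ i, v.1 i ≠ a) : bary v t a = 0 := by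
  simp only [bary, Finset.sum_apply, Pi.smul_apply, smul_eq_mul]
  refine Finset.sum_eq_zero fun i _ => ?_
  simp [(ha i).symm]

lemma simplexPoint_of_mem (v : Simplex K k) {t : EuclideanSpace ℝ (Fin k)} (ht : t ∈ corner k) :
    simplexPoint v t = ⟨bary v t, bary_mem v ht⟩ := dif_pos ht

/-- The edge of a simplex joining the first vertex to another one. -/
def Simplex.edge (v : Simplex K k) (l : Fin k) : Simplex K 1 :=
  ⟨OrderEmbedding.ofStrictMono (fun i : Fin 2 => v.1 (if i = 0 then 0 else l.succ)) (by
      intro i j hij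
      rw [Fin.lt_def] at hij
      have hi : i = 0 := Fin.ext (by simp only [Fin.val_zero]; omega)
      have hj : j = 1 := Fin.ext (by simp only [Fin.val_one]; omega)
      subst hi hj
      simp [Fin.succ_pos]), by
    refine mem_faces_of_subset v.2 ?_ (by simp)
    intro x hx
    simp only [Finset.mem_map, Finset.mem_univ, true_and] at hx ⊢
    obtain ⟨a, rfl⟩ := hx
    exact ⟨_, rfl⟩⟩

lemma bary_edge_zero (v : Simplex K k) (l : Fin k) : bary (v.edge l) 0 = bary v 0 := by
  ext a
  simp [bary, Fin.sum_univ_succ, Simplex.edge]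
  rfl

lemma bary_edge_single (v : Simplex K k) (l : Fin k) :
    bary (v.edge l) (EuclideanSpace.single 0 1) = bary v (EuclideanSpace.single l 1) := by
  ext a
  simp [bary, Fin.sum_univ_succ, Simplex.edge, PiLp.single_apply, ite_mul]
  rfl

end Simplex

/-! ### Comparison of a simplex with a Euclidean simplex -/

section Geometry

variable {N n k : ℕ} {M : Type*} [EMetricSpace M] [ChartedSpace (EuclideanSpace ℝ (Fin n)) M]
  (T : SmoothTriangulation n M N)

lemma SmoothTriangulation.edist_param_le_mesh (v : Simplex T.K k) (l : Fin k) :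
    edist (T.param v 0) (T.param v (EuclideanSpace.single l 1)) ≤ T.mesh := by
  have h0 : T.param (v.edge l) 0 = T.param v 0 := by
    simp only [SmoothTriangulation.param, simplexPoint_of_mem _ (zero_mem_corner _),
      bary_edge_zero]
  have h1 : T.param (v.edge l) (EuclideanSpace.single 0 1) =
      T.param v (EuclideanSpace.single l 1) := by
    simp only [SmoothTriangulation.param, simplexPoint_of_mem _ (single_mem_corner _),
      bary_edge_single]
  rw [← h0, ← h1]
  exact le_iSup (fun e : Simplex T.K 1 =>
    edist (T.param e 0) (T.param e (EuclideanSpace.single 0 1))) (v.edge l)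

/-- The Euclidean metric `(s, t) ↦ ‖A s - A t‖`, in the affine coordinates of the closed simplex
`v`, differs from the geodesic distance by a factor of at most `Λ`. -/
def SmoothTriangulation.IsComparison (v : Simplex T.K k) (Λ : ℝ≥0)
    (A : EuclideanSpace ℝ (Fin k) ≃L[ℝ] EuclideanSpace ℝ (Fin k)) : Prop :=
  ∀ s ∈ corner k, ∀ t ∈ corner k,
    edist (T.param v s) (T.param v t) ≤ Λ * edist (A s) (A t) ∧
    edist (A s) (A t) ≤ Λ * edist (T.param v s) (T.param v t)

variable {T} {v : Simplex T.K k} {Λ : ℝ≥0}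
  {A : EuclideanSpace ℝ (Fin k) ≃L[ℝ] EuclideanSpace ℝ (Fin k)}

lemma SmoothTriangulation.IsComparison.norm_single_le (hA : T.IsComparison v Λ A)
    (hmesh : T.mesh ≠ ⊤) (l : Fin k) :
    ‖A (EuclideanSpace.single l 1)‖ ≤ Λ * T.mesh.toReal := by
  have h := (hA 0 (zero_mem_corner k) _ (single_mem_corner l)).2.trans
    (mul_le_mul_right (T.edist_param_le_mesh v l) _)
  rw [map_zero, edist_eq_enorm_sub, zero_sub, enorm_neg, ← ofReal_norm] at h
  rw [← ENNReal.coe_toReal, ← ENNReal.toReal_mul]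
  exact (ENNReal.ofReal_le_iff_le_toReal (by finiteness)).1 h

/-- The upper half of the comparison bounds the metric speed of the parametrization, hence its
differential. -/
lemma SmoothTriangulation.IsComparison.norm_mfderivWithin_le [IsManifold (𝓡 n) 1 M]
    [RiemannianBundle (fun x : M => TangentSpace (𝓡 n) x)]
    [IsContinuousRiemannianBundle (EuclideanSpace ℝ (Fin n)) (fun x : M => TangentSpace (𝓡 n) x)]
    [IsRiemannianManifold (𝓡 n) M] (hA : T.IsComparison v Λ A)
    {t : EuclideanSpace ℝ (Fin k)} (ht : t ∈ interior (corner k))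
    (u : EuclideanSpace ℝ (Fin k)) :
    ‖mfderivWithin 𝓘(ℝ, EuclideanSpace ℝ (Fin k)) (𝓡 n) (T.param v) (corner k) t u‖ ≤
      Λ * ‖A u‖ := by
  have hnhds : corner k ∈ 𝓝 t := mem_interior_iff_mem_nhds.1 ht
  have htc : t ∈ corner k := interior_subset ht
  rw [mfderivWithin_of_mem_nhds hnhds]
  have hd : MDifferentiableAt 𝓘(ℝ, EuclideanSpace ℝ (Fin k)) (𝓡 n) (T.param v) t :=
    ((T.smooth v).mdifferentiableOn (by simp) t htc).mdifferentiableAt hnhds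
  refine norm_apply_le_of_hasMFDerivAt hd.hasMFDerivAt u (by positivity) ?_
  have hc : Filter.Tendsto (fun s : ℝ => t + s • u) (𝓝[>] 0) (𝓝 t) := by
    have hc : ContinuousAt (fun s : ℝ => t + s • u) 0 := by fun_prop
    rw [ContinuousAt, zero_smul, add_zero] at hc
    exact hc.mono_left nhdsWithin_le_nhds
  filter_upwards [hc.eventually hnhds, self_mem_nhdsWithin] with s hs hs0
  have hs0 : 0 < s := hs0
  refine (hA t htc _ hs).1.trans (le_of_eq ?_)
  rw [map_add, edist_eq_enorm_sub, sub_add_cancel_left, enorm_neg, map_smul, ← ofReal_norm,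
    norm_smul, Real.norm_of_nonneg hs0.le, ← ENNReal.ofReal_coe_nnreal,
    ← ENNReal.ofReal_mul Λ.coe_nonneg]
  congr 1
  ring

/-- The coordinate vectors of a `k`-simplex have length `O(η)`, so integration of a bounded form
over it gives `O(η ^ k)`. -/
lemma SmoothTriangulation.abs_deRham_le [IsManifold (𝓡 n) 1 M]
    [RiemannianBundle (fun x : M => TangentSpace (𝓡 n) x)]
    [IsContinuousRiemannianBundle (EuclideanSpace ℝ (Fin n)) (fun x : M => TangentSpace (𝓡 n) x)]
    [IsRiemannianManifold (𝓡 n) M] (hA : T.IsComparison v Λ A) (hmesh : T.mesh ≠ ⊤)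
    (w : SmoothForm n M) (hw : w.supNorm ≠ ⊤) :
    |T.deRham w k v| ≤ (n : ℝ) ^ k * (Λ * (Λ * T.mesh.toReal)) ^ k * w.supNorm.toReal *
      volume.real (corner k) := by
  rw [← Real.norm_eq_abs, SmoothTriangulation.deRham]
  refine norm_setIntegral_le_of_norm_le_const_ae' (volume_corner_lt_top k) ?_
  -- Differentials within `corner k` are controlled at interior points only; the frontier of a
  -- convex set is null.
  have hfr : ∀ᵐ t : EuclideanSpace ℝ (Fin k), t ∉ frontier (corner k) :=
    measure_eq_zero_iff_ae_notMem.1 ((convex_corner k).addHaar_frontier volume)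
  filter_upwards [hfr] with t ht htc
  have hti : t ∈ interior (corner k) := by
    by_contra h
    exact ht ⟨subset_closure htc, h⟩
  have h := abs_apply_le_pointwiseNorm (fun k => (w.val (T.param v t) k).toAlternatingMap)
    (k := k) (u := fun i => mfderivWithin 𝓘(ℝ, EuclideanSpace ℝ (Fin k)) (𝓡 n) (T.param v)
      (corner k) t (EuclideanSpace.single i (1 : ℝ))) (X := Λ * (Λ * T.mesh.toReal))
    fun i => (hA.norm_mfderivWithin_le hti _).trans
      (mul_le_mul_of_nonneg_left (hA.norm_single_le hmesh i) Λ.2)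
  refine h.trans (mul_le_mul_of_nonneg_left ?_ (by positivity))
  exact (ENNReal.ofReal_le_iff_le_toReal hw).1
    (le_iSup (fun p : M => ENNReal.ofReal (pointwiseNorm p fun k => (w.val p k).toAlternatingMap))
      (T.param v t))

lemma SmoothTriangulation.IsComparison.euclideanHausdorffMeasure_le [MeasurableSpace M]
    [BorelSpace M] (hA : T.IsComparison v Λ A) (d : ℕ) :
    (μHE[d] : Measure M) (T.param v '' corner k) ≤ Λ ^ d * μHE[d] (A '' corner k) := by
  have hlip : LipschitzOnWith Λ (T.param v ∘ A.symm) (A '' corner k) := by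
    rintro _ ⟨s, hs, rfl⟩ _ ⟨t, ht, rfl⟩
    simpa using (hA s hs t ht).1
  have h : T.param v '' corner k = (T.param v ∘ A.symm) '' (A '' corner k) := by
    rw [Set.image_comp, Set.image_image (g := A.symm)]
    simp
  rw [h]
  exact euclideanHausdorffMeasure_image_le hlip d

lemma SmoothTriangulation.IsComparison.riemannianVolume_eq_zero [MeasurableSpace M]
    [BorelSpace M] (hA : T.IsComparison v Λ A) (hk : k < n) :
    riemannianVolume n M (T.param v '' corner k) = 0 := by
  refine le_antisymm ((hA.euclideanHausdorffMeasure_le n).trans (le_of_eq ?_)) zero_le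
  have h0 : (μH[n] : Measure (EuclideanSpace ℝ (Fin k))) (A '' corner k) = 0 := by
    rw [Real.hausdorffMeasure_of_finrank_lt (by simpa using hk)]
    rfl
  rw [Measure.euclideanHausdorffMeasure_def, Measure.smul_apply, h0, smul_zero, mul_zero]

/-- Elimination of `D` from the bounds `h1` (from above by Cramer's rule) and `h2` (from below by
the fullness), where `D` stands for the determinant of the Euclidean metric. -/
lemma le_div_mul_of_mul_le_of_mul_pow_le {n : ℕ} {x D V Λ Θ η a : ℝ} (hn : 0 < n) (hx : 0 ≤ x)
    (hV : 0 ≤ V) (hΛ : 0 ≤ Λ) (hΘ : 0 < Θ) (hη : 0 < η) (h1 : x * D ≤ a * (Λ * η) ^ (n - 1))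
    (h2 : Θ * η ^ n ≤ Λ ^ n * (D * V)) : x ≤ Λ ^ (2 * n - 1) * V / Θ / η * a := by
  obtain ⟨m, rfl⟩ : ∃ m, n = m + 1 := ⟨n - 1, by omega⟩
  rw [show 2 * (m + 1) - 1 = m + 1 + m by omega]
  rw [Nat.add_sub_cancel] at h1
  have h3 : x * (Θ * η) * η ^ m ≤ Λ ^ (m + 1 + m) * V * a * η ^ m :=
    calc x * (Θ * η) * η ^ m = x * (Θ * η ^ (m + 1)) := by ring
      _ ≤ x * (Λ ^ (m + 1) * (D * V)) := mul_le_mul_of_nonneg_left h2 hx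
      _ = (x * D) * (Λ ^ (m + 1) * V) := by ring
      _ ≤ (a * (Λ * η) ^ m) * (Λ ^ (m + 1) * V) := mul_le_mul_of_nonneg_right h1 (by positivity)
      _ = _ := by rw [mul_pow]; ring
  have h4 := le_of_mul_le_mul_right h3 (by positivity)
  rw [div_div, div_mul_eq_mul_div, le_div_iff₀ (mul_pos hΘ hη)]
  exact h4

section TopDimensional

variable {v : Simplex T.K n} {Θ₀ : ℝ≥0}
  {A : EuclideanSpace ℝ (Fin n) ≃L[ℝ] EuclideanSpace ℝ (Fin n)}

lemma SmoothTriangulation.IsComparison.riemannianVolume_le [MeasurableSpace M]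
    [BorelSpace M] (hA : T.IsComparison v Λ A) :
    riemannianVolume n M (T.param v '' corner n) ≤
      Λ ^ n * (ENNReal.ofReal
        |LinearMap.det (A : EuclideanSpace ℝ (Fin n) →ₗ[ℝ] EuclideanSpace ℝ (Fin n))| *
        volume (corner n)) := by
  refine (hA.euclideanHausdorffMeasure_le n).trans (le_of_eq ?_)
  rw [EuclideanSpace.euclideanHausdorffMeasure_eq_volume,
    Measure.addHaar_image_continuousLinearEquiv]

/-- Fullness keeps the Euclidean simplex from degenerating: its volume is at least of order
`η ^ n`. -/
lemma SmoothTriangulation.IsComparison.mul_mesh_pow_le [MeasurableSpace M]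
    [BorelSpace M] (hA : T.IsComparison v Λ A) (hΘ : Θ₀ ≤ T.fullness) :
    Θ₀ * T.mesh.toReal ^ n ≤
      Λ ^ n * (|LinearMap.det (A : EuclideanSpace ℝ (Fin n) →ₗ[ℝ] EuclideanSpace ℝ (Fin n))| *
        volume.real (corner n)) := by
  have h1 : (Θ₀ : ℝ≥0∞) * T.mesh ^ n ≤ riemannianVolume n M (T.param v '' corner n) :=
    ENNReal.mul_le_of_le_div (hΘ.trans (iInf_le _ v))
  have hfin : (Λ : ℝ≥0∞) ^ n * (ENNReal.ofReal
      |LinearMap.det (A : EuclideanSpace ℝ (Fin n) →ₗ[ℝ] EuclideanSpace ℝ (Fin n))| *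
        volume (corner n)) ≠ ⊤ :=
    ENNReal.mul_ne_top (by finiteness)
      (ENNReal.mul_ne_top ENNReal.ofReal_ne_top (volume_corner_lt_top n).ne)
  have h2 := ENNReal.toReal_mono hfin (h1.trans hA.riemannianVolume_le)
  simpa [ENNReal.toReal_mul, Measure.real] using h2

lemma SmoothTriangulation.IsComparison.mesh_pos (hA : T.IsComparison v Λ A) (hmesh : T.mesh ≠ ⊤)
    (i : Fin n) : 0 < T.mesh.toReal := by
  refine ENNReal.toReal_nonneg.lt_of_ne fun h => ?_
  have h1 := hA.norm_single_le hmesh i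
  rw [← h, mul_zero, norm_le_zero_iff, map_eq_zero_iff _ A.injective] at h1
  simp at h1

/-- The affine coordinates of a full `n`-simplex are Lipschitz with constant `O(1 / η)` for its
Euclidean metric. -/
lemma SmoothTriangulation.IsComparison.abs_apply_le [MeasurableSpace M]
    [BorelSpace M] (hA : T.IsComparison v Λ A) (hmesh : T.mesh ≠ ⊤) (hΘ₀ : 0 < Θ₀)
    (hΘ : Θ₀ ≤ T.fullness) (x : EuclideanSpace ℝ (Fin n)) (i : Fin n) :
    |x i| ≤ Λ ^ (2 * n - 1) * volume.real (corner n) / Θ₀ / T.mesh.toReal * ‖A x‖ := by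
  have hη := hA.mesh_pos hmesh i
  have h1 := abs_apply_mul_abs_det_le
    (A : EuclideanSpace ℝ (Fin n) →ₗ[ℝ] EuclideanSpace ℝ (Fin n)) (hA.norm_single_le hmesh) x i
  have h2 := hA.mul_mesh_pow_le hΘ
  exact le_div_mul_of_mul_le_of_mul_pow_le i.pos (abs_nonneg _) measureReal_nonneg Λ.coe_nonneg
    (NNReal.coe_pos.2 hΘ₀) hη h1 h2

end TopDimensional

end Geometry

/-! ### Surjectivity and Lipschitz bound of the affine parametrization -/

section Simplex

variable {N : ℕ} {K : AbstractSimplicialComplex (Fin N)} {k : ℕ}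

lemma exists_bary_eq (v : Simplex K k) {x : Fin N → ℝ} (h0 : ∀ a, 0 ≤ x a) (h1 : ∑ a, x a = 1)
    (hx : ∀ a, (∀ i, v.1 i ≠ a) → x a = 0) : ∃ t ∈ corner k, bary v t = x := by
  have hsum : ∑ i, x (v.1 i) = 1 := by
    rw [← h1]
    refine (Finset.sum_map Finset.univ v.1.toEmbedding x).symm.trans ?_
    refine Finset.sum_subset (Finset.subset_univ _) fun a _ ha => hx a fun i hi => ha ?_
    simpa using ⟨i, hi⟩
  rw [Fin.sum_univ_succ] at hsum
  refine ⟨WithLp.toLp 2 fun j => x (v.1 j.succ), ⟨fun i => h0 _, ?_⟩, ?_⟩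
  · have := h0 (v.1 0)
    simp only
    linarith
  · ext a
    by_cases ha : ∃ i, v.1 i = a
    · obtain ⟨i, rfl⟩ := ha
      rw [bary_apply_vertex]
      refine Fin.cases ?_ (fun j => ?_) i
      · simp only [Fin.cons_zero]
        linarith
      · simp
    · push Not at ha
      rw [bary_apply_of_notMem v _ ha, hx a ha]

lemma abs_bary_sub_le (v : Simplex K k) (s t : EuclideanSpace ℝ (Fin k)) (a : Fin N) :
    |bary v t a - bary v s a| ≤ ∑ j, |(t - s) j| := by
  by_cases ha : ∃ i, v.1 i = a
  · obtain ⟨i, rfl⟩ := ha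
    rw [bary_apply_vertex, bary_apply_vertex]
    refine Fin.cases ?_ (fun j => ?_) i
    · simp only [Fin.cons_zero]
      have : 1 - ∑ j, t j - (1 - ∑ j, s j) = -∑ j, (t - s) j := by
        simp only [PiLp.sub_apply, Finset.sum_sub_distrib]; ring
      rw [this, abs_neg]
      exact Finset.abs_sum_le_sum_abs _ _
    · simp only [Fin.cons_succ]
      exact Finset.single_le_sum (f := fun j => |(t - s) j|) (fun _ _ => abs_nonneg _)
        (Finset.mem_univ j)
  · push Not at ha
    rw [bary_apply_of_notMem v _ ha, bary_apply_of_notMem v _ ha, sub_zero, abs_zero]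
    exact Finset.sum_nonneg fun _ _ => abs_nonneg _

end Simplex

/-! ### Barycentric coordinates as functions on the manifold -/

section Points

variable {N n k : ℕ} {M : Type*} [EMetricSpace M] [ChartedSpace (EuclideanSpace ℝ (Fin n)) M]
  {T : SmoothTriangulation n M N}

lemma SmoothTriangulation.mu_param (v : Simplex T.K k) {t : EuclideanSpace ℝ (Fin k)}
    (ht : t ∈ corner k) (a : Fin N) : T.mu a (T.param v t) = bary v t a := by
  rw [SmoothTriangulation.mu, SmoothTriangulation.param, T.homeo.symm_apply_apply,
    simplexPoint_of_mem v ht]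

lemma SmoothTriangulation.continuous_mu (a : Fin N) : Continuous (T.mu a) :=
  (continuous_apply a).comp (continuous_subtype_val.comp T.homeo.symm.continuous)

lemma SmoothTriangulation.mu_nonneg (a : Fin N) (p : M) : 0 ≤ T.mu a p := (T.homeo.symm p).2.1 a

lemma SmoothTriangulation.sum_mu (p : M) : ∑ a, T.mu a p = 1 := (T.homeo.symm p).2.2.1

lemma SmoothTriangulation.mu_le_one (a : Fin N) (p : M) : T.mu a p ≤ 1 := by
  rw [← T.sum_mu p]
  exact Finset.single_le_sum (f := fun a => T.mu a p) (fun a _ => T.mu_nonneg a p)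
    (Finset.mem_univ a)

lemma SmoothTriangulation.mem_image_param (v : Simplex T.K k) {p : M}
    (hp : ∀ a, (∀ i, v.1 i ≠ a) → T.mu a p = 0) : p ∈ T.param v '' corner k := by
  obtain ⟨t, ht, htx⟩ := exists_bary_eq v (T.mu_nonneg · p) (T.sum_mu p) hp
  refine ⟨t, ht, ?_⟩
  rw [SmoothTriangulation.param, simplexPoint_of_mem v ht]
  exact (T.homeo.toEquiv.eq_symm_apply.1 (Subtype.ext htx))

variable (T) in
/-- Every point lies in the interior of a simplex, namely the one spanned by the vertices whose
barycentric coordinates do not vanish. -/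
lemma SmoothTriangulation.exists_simplex (p : M) : ∃ k, ∃ v : Simplex T.K k,
    ∀ a, 0 < T.mu a p ↔ ∃ i, v.1 i = a := by
  have hs := (T.homeo.symm p).2.2.2
  set s := Finset.univ.filter fun i => (T.homeo.symm p).1 i ≠ 0 with hsdef
  have hne : s.Nonempty := (T.K.isRelLowerSet_faces hs).1
  have hcard : s.card = s.card - 1 + 1 := by have := hne.card_pos; omega
  have hr : Set.range (s.orderEmbOfFin hcard) = s := s.range_orderEmbOfFin hcard
  refine ⟨s.card - 1, ⟨s.orderEmbOfFin hcard, ?_⟩, fun a => ?_⟩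
  · convert hs using 1
    apply Finset.coe_injective
    rw [Finset.coe_map, Finset.coe_univ, Set.image_univ]
    exact hr
  · have h1 : (∃ i, s.orderEmbOfFin hcard i = a) ↔ a ∈ s := by
      rw [← Finset.mem_coe, ← hr]; rfl
    rw [h1, hsdef, Finset.mem_filter]
    simp only [Finset.mem_univ, true_and]
    exact ⟨fun h => h.ne', fun h => (T.mu_nonneg a p).lt_of_ne' h⟩

/-- The parametrization of a simplex is an immersion into an `n`-dimensional manifold. -/
lemma SmoothTriangulation.dim_le (v : Simplex T.K k) : k ≤ n := by
  have h := T.immersive v 0 (zero_mem_corner k)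
  have h1 := LinearMap.finrank_le_finrank_of_injective (f := (mfderivWithin
    𝓘(ℝ, EuclideanSpace ℝ (Fin k)) (𝓡 n) (fun t => T.homeo (simplexPoint v t)) (corner k) 0 :
      EuclideanSpace ℝ (Fin k) →L[ℝ] EuclideanSpace ℝ (Fin n)).toLinearMap) h
  rwa [show Module.finrank ℝ (TangentSpace 𝓘(ℝ, EuclideanSpace ℝ (Fin k))
      (0 : EuclideanSpace ℝ (Fin k))) = k from finrank_euclideanSpace_fin,
    show Module.finrank ℝ (TangentSpace (𝓡 n) (T.homeo (simplexPoint v 0))) = n from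
      finrank_euclideanSpace_fin] at h1

/-- A further vertex with positive barycentric coordinate would span, together with `v`, a simplex
of dimension greater than `n`. Hence the interior of an `n`-simplex is cut out by the open conditions
`0 < μᵢ`. -/
lemma SmoothTriangulation.mu_eq_zero (v : Simplex T.K n) {p : M} (hp : ∀ i, 0 < T.mu (v.1 i) p)
    {a : Fin N} (ha : ∀ i, v.1 i ≠ a) : T.mu a p = 0 := by
  obtain ⟨k, v', hv'⟩ := T.exists_simplex p
  have hsub : Finset.univ.map v.1.toEmbedding ⊆ Finset.univ.map v'.1.toEmbedding := by
    intro b hb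
    simp only [Finset.mem_map, Finset.mem_univ, true_and] at hb ⊢
    obtain ⟨i, rfl⟩ := hb
    exact (hv' _).1 (hp i)
  have heq := Finset.eq_of_subset_of_card_le hsub (by simpa using T.dim_le v')
  refine le_antisymm (not_lt.1 fun h => ?_) (T.mu_nonneg a p)
  obtain ⟨i, hi⟩ := (hv' a).1 h
  have hmem : a ∈ Finset.univ.map v'.1.toEmbedding := by simpa using ⟨i, hi⟩
  rw [← heq] at hmem
  obtain ⟨i', -, hi'⟩ := Finset.mem_map.1 hmem
  exact ha i' hi'

lemma SmoothTriangulation.eventually_mu_pos (v : Simplex T.K k) {p : M}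
    (hp : ∀ i, 0 < T.mu (v.1 i) p) : ∀ᶠ q in 𝓝 p, ∀ i, 0 < T.mu (v.1 i) q :=
  Filter.eventually_all.2 fun i => (T.continuous_mu (v.1 i)).continuousAt.eventually_const_lt (hp i)

lemma SmoothTriangulation.dmu_eq_zero (v : Simplex T.K n) {p : M} (hp : ∀ i, 0 < T.mu (v.1 i) p)
    {a : Fin N} (ha : ∀ i, v.1 i ≠ a) : T.dmu a p = 0 := by
  have h : T.mu a =ᶠ[𝓝 p] fun _ => (0 : ℝ) := by
    filter_upwards [T.eventually_mu_pos v hp] with q hq using T.mu_eq_zero v hq ha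
  have h2 : (mfderiv (𝓡 n) 𝓘(ℝ, ℝ) (T.mu a) p : TangentSpace (𝓡 n) p →L[ℝ] ℝ) = 0 :=
    h.mfderiv_eq.trans mfderiv_const
  rw [SmoothTriangulation.dmu, h2]
  rfl

/-! ### Almost every point lies inside an n-simplex -/

section Measure

variable [MeasurableSpace M] [BorelSpace M] {Λ : ℝ≥0}

/-- Simplices of dimension less than `n` are null sets, being Lipschitz images of sets in a
Euclidean space of smaller dimension. -/
lemma SmoothTriangulation.IsCommensurable.ae_exists_simplex (hT : T.IsCommensurable Λ) :
    ∀ᵐ p ∂(riemannianVolume n M), ∃ v : Simplex T.K n, ∀ i, 0 < T.mu (v.1 i) p := by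
  have hnull : riemannianVolume n M
      (⋃ k : Fin n, ⋃ v : Simplex T.K k, T.param v '' corner k) = 0 := by
    refine measure_iUnion_null fun k => measure_iUnion_null fun v => ?_
    obtain ⟨A, hA⟩ := hT k v
    exact SmoothTriangulation.IsComparison.riemannianVolume_eq_zero hA k.2
  filter_upwards [measure_eq_zero_iff_ae_notMem.1 hnull] with p hp
  obtain ⟨k, v, hv⟩ := T.exists_simplex p
  rcases (T.dim_le v).lt_or_eq with hk | rfl
  · refine absurd ?_ hp
    refine Set.mem_iUnion.2 ⟨⟨k, hk⟩, Set.mem_iUnion.2 ⟨v, T.mem_image_param v fun a ha => ?_⟩⟩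
    refine le_antisymm (not_lt.1 fun h => ?_) (T.mu_nonneg a p)
    obtain ⟨i, hi⟩ := (hv a).1 h
    exact ha i hi
  · exact ⟨v, fun i => (hv _).2 ⟨i, rfl⟩⟩

/-- `M` is covered, up to a null set, by finitely many `n`-simplices, each of finite volume by
comparison with a Euclidean simplex. -/
lemma SmoothTriangulation.IsCommensurable.riemannianVolume_univ_ne_top
    (hT : T.IsCommensurable Λ) : riemannianVolume n M Set.univ ≠ ⊤ := by
  have hsub : ∀ᵐ p ∂(riemannianVolume n M), p ∈ ⋃ v : Simplex T.K n, T.param v '' corner n := by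
    filter_upwards [hT.ae_exists_simplex] with p ⟨v, hv⟩
    exact Set.mem_iUnion.2 ⟨v, T.mem_image_param v fun a ha => T.mu_eq_zero v hv ha⟩
  rw [← measure_congr (Filter.eventuallyEq_univ.2 hsub)]
  refine ((measure_iUnion_le _).trans_lt ?_).ne
  rw [tsum_fintype]
  refine ENNReal.sum_lt_top.2 fun v _ => ?_
  obtain ⟨A, hA⟩ := hT n v
  refine (SmoothTriangulation.IsComparison.riemannianVolume_le hA).trans_lt ?_
  have := volume_corner_lt_top n
  finiteness

end Measure

/-! ### Differentials of the barycentric coordinates -/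

section Gradient

variable [MeasurableSpace M] [BorelSpace M] {Λ Θ₀ : ℝ≥0} [IsManifold (𝓡 n) 1 M]
    [RiemannianBundle (fun x : M => TangentSpace (𝓡 n) x)]
    [IsContinuousRiemannianBundle (EuclideanSpace ℝ (Fin n)) (fun x : M => TangentSpace (𝓡 n) x)]
    [IsRiemannianManifold (𝓡 n) M]

/-- The constant in the bound of the differentials of the barycentric coordinates by the inverse of
the mesh. -/
def gradientConst (n : ℕ) (Θ₀ Λ : ℝ≥0) : ℝ :=
  n * (Λ ^ (2 * n - 1) * volume.real (corner n) / Θ₀) * Λ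

lemma gradientConst_nonneg (n : ℕ) (Θ₀ Λ : ℝ≥0) : 0 ≤ gradientConst n Θ₀ Λ := by
  unfold gradientConst
  have : 0 ≤ volume.real (corner n) := measureReal_nonneg
  positivity

/-- The differentials of the barycentric coordinates are `O(1 / η)` in the interiors of the
`n`-simplices. -/
lemma SmoothTriangulation.IsComparison.abs_dmu_le {v : Simplex T.K n}
    {A : EuclideanSpace ℝ (Fin n) ≃L[ℝ] EuclideanSpace ℝ (Fin n)}
    (hA : T.IsComparison v Λ A) (hmesh : T.mesh ≠ ⊤) (hΘ₀ : 0 < Θ₀)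
    (hΘ : Θ₀ ≤ T.fullness) {p : M} (hp : ∀ i, 0 < T.mu (v.1 i) p) (a : Fin N)
    (u : TangentSpace (𝓡 n) p) :
    |T.dmu a p u| ≤ gradientConst n Θ₀ Λ / T.mesh.toReal * ‖u‖ := by
  have hc := gradientConst_nonneg n Θ₀ Λ
  have hη : 0 ≤ T.mesh.toReal := ENNReal.toReal_nonneg
  -- Where `μₐ` is not differentiable, `mfderiv` is zero by convention and the bound is trivial, so
  -- differentiability of `μₐ` need not be established.
  by_cases hd : MDifferentiableAt (𝓡 n) 𝓘(ℝ, ℝ) (T.mu a) p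
  swap
  · rw [SmoothTriangulation.dmu, mfderiv_zero_of_not_mdifferentiableAt hd]
    change |(0 : ℝ)| ≤ _
    rw [abs_zero]
    positivity
  refine abs_apply_le_of_hasMFDerivAt hd.hasMFDerivAt (by positivity) ?_ u
  obtain ⟨s, hs, rfl⟩ := T.mem_image_param v fun a ha => T.mu_eq_zero v hp ha
  filter_upwards [T.eventually_mu_pos v hp] with q hq
  obtain ⟨t, ht, rfl⟩ := T.mem_image_param v fun a ha => T.mu_eq_zero v hq ha
  rw [T.mu_param v ht, T.mu_param v hs]
  have hV : 0 ≤ volume.real (corner n) := measureReal_nonneg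
  obtain ⟨c, hcdef⟩ : ∃ c : ℝ, c =
    n * (Λ ^ (2 * n - 1) * volume.real (corner n) / Θ₀) / T.mesh.toReal := ⟨_, rfl⟩
  have hc0 : 0 ≤ c := by rw [hcdef]; positivity
  have h1 : |bary v t a - bary v s a| ≤ c * ‖A (t - s)‖ := by
    refine (abs_bary_sub_le v s t a).trans ((Finset.sum_le_card_nsmul _ _ _ fun i _ =>
      hA.abs_apply_le hmesh hΘ₀ hΘ (t - s) i).trans (le_of_eq ?_))
    rw [Finset.card_univ, Fintype.card_fin, nsmul_eq_mul, hcdef]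
    ring
  calc ENNReal.ofReal |bary v t a - bary v s a| ≤ ENNReal.ofReal (c * ‖A (t - s)‖) :=
        ENNReal.ofReal_le_ofReal h1
    _ = ENNReal.ofReal c * edist (A t) (A s) := by
        rw [ENNReal.ofReal_mul hc0, edist_eq_enorm_sub, ← ofReal_norm, map_sub]
    _ ≤ ENNReal.ofReal c * (Λ * edist (T.param v t) (T.param v s)) := by
        gcongr
        exact (hA t ht s hs).2
    _ = ENNReal.ofReal (gradientConst n Θ₀ Λ / T.mesh.toReal) *
        edist (T.param v t) (T.param v s) := by
        rw [← mul_assoc, ← ENNReal.ofReal_coe_nnreal (p := Λ), ← ENNReal.ofReal_mul hc0, hcdef,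
          gradientConst]
        congr 2
        ring

end Gradient
end Points

/-! ### Local operations on cochains -/

section Operations

/-- The complex of all faces of a `k`-simplex. -/
abbrev fullSimplex (k : ℕ) : AbstractSimplicialComplex (Fin (k + 1)) := ⊤

/-- The top-dimensional simplex of `fullSimplex k`. -/
def topSimplex (k : ℕ) : Simplex (fullSimplex k) k :=
  ⟨RelEmbedding.refl _, Finset.univ_nonempty.map⟩

lemma dim_le_of_simplex_fullSimplex {k d : ℕ} (v : Simplex (fullSimplex k) d) : d ≤ k := by
  simpa using Fintype.card_le_of_injective v.1 v.1.injective

variable {N : ℕ} {K : AbstractSimplicialComplex (Fin N)} {k : ℕ}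

lemma map_mem_faces (s : Simplex K k) :
    ∀ t ∈ (fullSimplex k).faces, t.map s.1.toEmbedding ∈ K.faces := fun _ ht =>
  mem_faces_of_subset s.2 (Finset.map_subset_map.2 (Finset.subset_univ _)) (Finset.Nonempty.map ht)

open Classical in
/-- The cochain that is `1` on one simplex and `0` on all others. -/
def basisCochain (σ : Σ d : ℕ, Simplex K d) : Cochain K := fun d τ =>
  if (⟨d, τ⟩ : Σ d : ℕ, Simplex K d) = σ then 1 else 0

lemma basisCochain_mem (σ : Σ d : ℕ, Simplex K d) : basisCochain σ ∈ cochainGrading K σ.1 := by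
  intro d hd
  ext τ
  refine if_neg fun h => hd ?_
  rw [← h]

/-- The simplices of `fullSimplex k`. -/
abbrev Faces (k : ℕ) : Type := Σ d : Fin (k + 1), Simplex (fullSimplex k) d

lemma sum_smul_basisCochain (c : Cochain (fullSimplex k)) :
    c = ∑ r : Faces k, c r.1 r.2 • basisCochain ⟨r.1, r.2⟩ := by
  ext d τ
  rw [Finset.sum_apply, Finset.sum_apply]
  have hd : d < k + 1 := Nat.lt_succ_of_le (dim_le_of_simplex_fullSimplex τ)
  rw [Finset.sum_eq_single (⟨⟨d, hd⟩, τ⟩ : Faces k)]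
  · simp [basisCochain]
  · rintro ⟨⟨d', hd'⟩, τ'⟩ - hne
    have : ¬ (⟨d, τ⟩ : Σ d : ℕ, Simplex (fullSimplex k) d) = ⟨d', τ'⟩ := by
      intro h
      cases h
      exact hne rfl
    simp [basisCochain, this]
  · simp

variable (S : CanonicalLocalExtension)

/-- The sum of the absolute values of the structure constants of `m_j` on a closed `k`-simplex. -/
def structureConst (k j : ℕ) : ℝ :=
  ∑ r : Fin j → Faces k,
    |S.m (fullSimplex k) j (fun i => basisCochain ⟨(r i).1, (r i).2⟩) k (topSimplex k)|

lemma structureConst_nonneg (k j : ℕ) : 0 ≤ structureConst S k j :=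
  Finset.sum_nonneg fun _ _ => abs_nonneg _

/-- Multilinear expansion of `m_j` in the basis of cochains dual to the faces. -/
lemma abs_m_fullSimplex_le {j : ℕ} (c : Fin j → Cochain (fullSimplex k))
    {X : Fin j → ℝ} {Y : ℝ} (hc : ∀ i d (τ : Simplex (fullSimplex k) d), |c i d τ| ≤ X i * Y ^ d) :
    |S.m (fullSimplex k) j c k (topSimplex k)| ≤
      structureConst S k j * ((∏ i, X i) * Y ^ (k + j - 2)) := by
  have hexp : S.m (fullSimplex k) j c k (topSimplex k) = ∑ r : Fin j → Faces k,
      (∏ i, c i (r i).1 (r i).2) *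
        S.m (fullSimplex k) j (fun i => basisCochain ⟨(r i).1, (r i).2⟩) k (topSimplex k) := by
    conv_lhs => rw [funext fun i => sum_smul_basisCochain (c i), MultilinearMap.map_sum]
    rw [Finset.sum_apply, Finset.sum_apply]
    refine Finset.sum_congr rfl fun r _ => ?_
    rw [MultilinearMap.map_smul_univ]
    rfl
  rw [hexp, structureConst, Finset.sum_mul]
  refine (Finset.abs_sum_le_sum_abs _ _).trans (Finset.sum_le_sum fun r _ => ?_)
  rw [abs_mul, mul_comm]
  -- As `m_j` has degree `2 - j`, its structure constants vanish unless the dimensions of the faces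
  -- add up to `k + j - 2`.
  by_cases hdeg : (k : ℤ) = ∑ i, ((r i).1 : ℤ) + 2 - j
  · refine mul_le_mul_of_nonneg_left ?_ (abs_nonneg _)
    have hsum : ∑ i, ((r i).1 : ℕ) = k + j - 2 := by
      have : ((∑ i, ((r i).1 : ℕ) : ℕ) : ℤ) = ∑ i, ((r i).1 : ℤ) := by push_cast; rfl
      omega
    rw [Finset.abs_prod, ← hsum, ← Finset.prod_pow_eq_pow_sum, ← Finset.prod_mul_distrib]
    exact Finset.prod_le_prod (fun _ _ => abs_nonneg _) fun i _ => hc i _ _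
  · have h := (S.isCInfinity (fullSimplex k)).degree j (fun i => ((r i).1 : ℤ))
      (fun i => basisCochain ⟨(r i).1, (r i).2⟩)
      (fun i => basisCochain_mem (⟨(r i).1, (r i).2⟩ : Σ d : ℕ, Simplex (fullSimplex k) d)) k hdeg
    rw [h]
    simp

/-- The value of `m_j` on a `k`-simplex is computed in the closed simplex, by locality; for reasons
of degree only tuples of faces with dimensions adding up to `k + j - 2` contribute. -/
lemma abs_m_le {j : ℕ} (c : Fin j → Cochain K) {X : Fin j → ℝ} {Y : ℝ}
    (hc : ∀ i d (τ : Simplex K d), |c i d τ| ≤ X i * Y ^ d) (s : Simplex K k) :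
    |S.m K j c k s| ≤ structureConst S k j * ((∏ i, X i) * Y ^ (k + j - 2)) := by
  have h := S.natural K (fullSimplex k) s.1 (map_mem_faces s) j c
  have h1 : S.m K j c k s = S.m (fullSimplex k) j
      (fun i => pullback s.1 (map_mem_faces s) (c i)) k (topSimplex k) := by
    rw [← h]; rfl
  rw [h1]
  exact abs_m_fullSimplex_le S _ fun i d τ => hc i d _

end Operations

/-! ### Pointwise bound of Whitney forms -/

section Whitney

lemma Simplex.eq_of_map_univ_eq {N : ℕ} {K : AbstractSimplicialComplex (Fin N)} {k : ℕ}
    {s s' : Simplex K k}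
    (h : Finset.univ.map s.1.toEmbedding = Finset.univ.map s'.1.toEmbedding) : s = s' := by
  refine Subtype.ext (OrderEmbedding.range_inj.1 ?_)
  have := congrArg (fun t : Finset (Fin N) => (t : Set (Fin N))) h
  simpa using this

variable {N n k : ℕ} {M : Type*} [EMetricSpace M] [ChartedSpace (EuclideanSpace ℝ (Fin n)) M]
  {T : SmoothTriangulation n M N}

/-- In the interior of the `n`-simplex `v`, only the Whitney forms of the at most `2 ^ (n + 1)`
faces of `v` do not vanish. The bound does not depend on the number of simplices of the triangulation. -/
lemma SmoothTriangulation.abs_whitney_le {v : Simplex T.K n} {p : M}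
    (hp : ∀ i, 0 < T.mu (v.1 i) p) {c : Cochain T.K} {B G : ℝ} (hB : ∀ s, |c k s| ≤ B)
    (hB0 : 0 ≤ B) (hG : 0 ≤ G) {u : Fin k → TangentSpace (𝓡 n) p}
    (hu : ∀ a j, |T.dmu a p (u j)| ≤ G) :
    |T.whitney c p k u| ≤
      2 ^ (n + 1) * (B * (k.factorial * ((k + 1) * (k.factorial * G ^ k)))) := by
  classical
  let F : Finset (Simplex T.K k) :=
    Finset.univ.filter fun s => Finset.univ.map s.1.toEmbedding ⊆ Finset.univ.map v.1.toEmbedding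
  have hcard : F.card ≤ 2 ^ (n + 1) := by
    have h1 : F.card ≤ (Finset.univ.map v.1.toEmbedding).powerset.card := by
      refine Finset.card_le_card_of_injOn (fun s => Finset.univ.map s.1.toEmbedding) ?_ ?_
      · intro s hs
        exact Finset.mem_coe.2 (Finset.mem_powerset.2 (Finset.mem_filter.1 hs).2)
      · intro s _ s' _ h
        exact Simplex.eq_of_map_univ_eq h
    simpa using h1
  have hsum : T.whitney c p k u = ∑ s ∈ F, c k s *
      whitneyExpr (fun i => T.mu (s.1 i) p) (fun i => T.dmu (s.1 i) p) u := by
    have h1 : T.whitney c p k u = ∑ s : Simplex T.K k, c k s *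
        whitneyExpr (fun i => T.mu (s.1 i) p) (fun i => T.dmu (s.1 i) p) u :=
      map_sum ((AddMonoidHom.mk' (fun f : TangentSpace (𝓡 n) p [⋀^Fin k]→ₗ[ℝ] ℝ => f u)
        fun _ _ => rfl)) _ _
    rw [h1]
    refine (Finset.sum_subset (Finset.subset_univ _) fun s _ hs => ?_).symm
    have hs' : ¬ Finset.univ.map s.1.toEmbedding ⊆ Finset.univ.map v.1.toEmbedding := by
      simpa [F] using hs
    obtain ⟨a, ha, hav⟩ := Finset.not_subset.1 hs'
    obtain ⟨i, -, rfl⟩ := Finset.mem_map.1 ha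
    have hne : ∀ l, v.1 l ≠ s.1 i := fun l hl => hav (by simpa using ⟨l, hl⟩)
    rw [whitneyExpr_eq_zero (i₀ := i) (T.mu_eq_zero v hp hne) (T.dmu_eq_zero v hp hne)]
    simp
  rw [hsum]
  refine (Finset.abs_sum_le_sum_abs _ _).trans ?_
  refine (Finset.sum_le_card_nsmul _ _
    (B * (k.factorial * ((k + 1) * (k.factorial * G ^ k)))) fun s _ => ?_).trans ?_
  · rw [abs_mul]
    refine mul_le_mul (hB s) (abs_whitneyExpr_apply_le (fun i => ?_) fun i j => hu _ _)
      (abs_nonneg _) hB0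
    rw [abs_of_nonneg (T.mu_nonneg _ p)]
    exact T.mu_le_one _ p
  · rw [nsmul_eq_mul]
    refine mul_le_mul_of_nonneg_right ?_ (by positivity)
    exact_mod_cast hcard

end Whitney

/-! ### The estimate of the higher operations -/

section Estimate

variable {n : ℕ} {M : Type*} [EMetricSpace M] [ChartedSpace (EuclideanSpace ℝ (Fin n)) M]
  [IsManifold (𝓡 n) 1 M] [RiemannianBundle (fun x : M => TangentSpace (𝓡 n) x)]
  [IsContinuousRiemannianBundle (EuclideanSpace ℝ (Fin n)) (fun x : M => TangentSpace (𝓡 n) x)]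
  [IsRiemannianManifold (𝓡 n) M]
  {N : ℕ} {T : SmoothTriangulation n M N} {Λ Θ₀ : ℝ≥0}

/-- The sum of the volumes of the standard simplices of dimension at most `n`. -/
def cornerConst (n : ℕ) : ℝ := ∑ d ∈ Finset.range (n + 1), volume.real (corner d)

lemma cornerConst_nonneg (n : ℕ) : 0 ≤ cornerConst n :=
  Finset.sum_nonneg fun _ _ => measureReal_nonneg

lemma SmoothTriangulation.IsCommensurable.abs_deRham_le (hT : T.IsCommensurable Λ)
    (hmesh : T.mesh ≠ ⊤) {w : SmoothForm n M} (hw : w.supNorm ≠ ⊤) (d : ℕ) (τ : Simplex T.K d) :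
    |T.deRham w d τ| ≤ cornerConst n * w.supNorm.toReal *
      ((n : ℝ) * Λ ^ 2 * T.mesh.toReal) ^ d := by
  obtain ⟨A, hA⟩ := hT d τ
  have h := SmoothTriangulation.abs_deRham_le hA hmesh w hw
  have hV : volume.real (corner d) ≤ cornerConst n :=
    Finset.single_le_sum (f := fun d => volume.real (corner d)) (fun _ _ => measureReal_nonneg)
      (Finset.mem_range_succ_iff.2 (T.dim_le τ))
  have hη : 0 ≤ T.mesh.toReal := ENNReal.toReal_nonneg
  have hs : 0 ≤ w.supNorm.toReal := ENNReal.toReal_nonneg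
  refine h.trans ((mul_le_mul_of_nonneg_left hV (by positivity)).trans (le_of_eq ?_))
  rw [mul_pow, mul_pow, mul_pow, mul_pow]
  ring

/-- The constant in the pointwise estimate of the degree `k` component of `W (m_j (R ω))`. -/
def whitneyConst (S : CanonicalLocalExtension) (n : ℕ) (Θ₀ Λ : ℝ≥0) (j k : ℕ) : ℝ :=
  2 ^ (n + 1) * (structureConst S k j * (cornerConst n ^ j * ((n : ℝ) * Λ ^ 2) ^ (k + j - 2)) *
    (k.factorial * ((k + 1) * (k.factorial * gradientConst n Θ₀ Λ ^ k))))

lemma whitneyConst_nonneg (S : CanonicalLocalExtension) (n : ℕ) (Θ₀ Λ : ℝ≥0) (j k : ℕ) :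
    0 ≤ whitneyConst S n Θ₀ Λ j k := by
  have h1 := structureConst_nonneg S k j
  have h2 := cornerConst_nonneg n
  have h3 := gradientConst_nonneg n Θ₀ Λ
  unfold whitneyConst
  positivity

/-- For `η = 0`, which occurs if `n = 0`, the left hand side is zero because `k + j - 2 > 0`. -/
lemma pow_mul_div_pow_le {η G : ℝ} (h0 : 0 ≤ η) (h1 : η ≤ 1) (hG : 0 ≤ G) {j k : ℕ} (hj : 3 ≤ j) :
    η ^ (k + j - 2) * (G / η) ^ k ≤ G ^ k * η := by
  rcases h0.eq_or_lt with rfl | hpos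
  · rw [zero_pow (by omega), zero_mul, mul_zero]
  · have h2 : η ^ (k + j - 2) = η ^ k * (η ^ (j - 3) * η) := by
      rw [← pow_succ, ← pow_add]; congr 1; omega
    have h3 : η ^ (k + j - 2) * (G / η) ^ k = G ^ k * (η ^ (j - 3) * η) := by
      rw [h2, div_pow]; field_simp
    rw [h3]
    refine mul_le_mul_of_nonneg_left ?_ (by positivity)
    exact mul_le_of_le_one_left h0 (pow_le_one₀ h0 h1)

variable [MeasurableSpace M] [BorelSpace M]

/-- In the interior of an `n`-simplex, the power `η ^ (k + j - 2)` in the bound of `m_j` on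
`k`-simplices more than compensates for the factor `η ^ (-k)` of the Whitney forms of
degree `k`. -/
lemma SmoothTriangulation.IsCommensurable.abs_whitney_m_deRham_le (hT : T.IsCommensurable Λ)
    (S : CanonicalLocalExtension) (hmesh : T.mesh ≤ 1) (hΘ₀ : 0 < Θ₀) (hΘ : Θ₀ ≤ T.fullness)
    {j : ℕ} (hj : 3 ≤ j) {w : Fin j → SmoothForm n M} (hw : ∀ i, (w i).supNorm ≠ ⊤)
    {v : Simplex T.K n} {p : M} (hp : ∀ i, 0 < T.mu (v.1 i) p) {k : ℕ}
    {u : Fin k → TangentSpace (𝓡 n) p} (hu : ∀ i, ‖u i‖ = 1) :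
    |T.whitney (S.m T.K j fun i => T.deRham (w i)) p k u| ≤
      whitneyConst S n Θ₀ Λ j k * ((∏ i, (w i).supNorm.toReal) * T.mesh.toReal) := by
  have hmesh' : T.mesh ≠ ⊤ := ne_top_of_le_ne_top ENNReal.one_ne_top hmesh
  have hη0 : 0 ≤ T.mesh.toReal := ENNReal.toReal_nonneg
  have hη1 : T.mesh.toReal ≤ 1 := by simpa using ENNReal.toReal_mono ENNReal.one_ne_top hmesh
  obtain ⟨A, hA⟩ := hT n v
  have hG := gradientConst_nonneg n Θ₀ Λ
  have hP : 0 ≤ ∏ i, (w i).supNorm.toReal := Finset.prod_nonneg fun _ _ => ENNReal.toReal_nonneg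
  have hS := structureConst_nonneg S k j
  have hC := cornerConst_nonneg n
  have hm := fun s : Simplex T.K k => abs_m_le S (fun i => T.deRham (w i))
    (fun i d τ => hT.abs_deRham_le hmesh' (hw i) d τ) s
  have hdmu : ∀ a i, |T.dmu a p (u i)| ≤ gradientConst n Θ₀ Λ / T.mesh.toReal := fun a i => by
    have := SmoothTriangulation.IsComparison.abs_dmu_le hA hmesh' hΘ₀ hΘ hp a (u i)
    rwa [hu i, mul_one] at this
  have hprod : ∏ i, (cornerConst n * (w i).supNorm.toReal) =
      cornerConst n ^ j * ∏ i, (w i).supNorm.toReal := by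
    rw [Finset.prod_mul_distrib, Finset.prod_const, Finset.card_univ, Fintype.card_fin]
  rw [hprod] at hm
  refine (T.abs_whitney_le hp hm (by positivity) (by positivity) hdmu).trans ?_
  rw [mul_pow _ T.mesh.toReal, whitneyConst]
  calc _ = 2 ^ (n + 1) * (structureConst S k j * (cornerConst n ^ j *
        ((n : ℝ) * Λ ^ 2) ^ (k + j - 2)) * (k.factorial * ((k + 1) * k.factorial))) *
        (∏ i, (w i).supNorm.toReal) *
        (T.mesh.toReal ^ (k + j - 2) * (gradientConst n Θ₀ Λ / T.mesh.toReal) ^ k) := by ring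
    _ ≤ 2 ^ (n + 1) * (structureConst S k j * (cornerConst n ^ j *
        ((n : ℝ) * Λ ^ 2) ^ (k + j - 2)) * (k.factorial * ((k + 1) * k.factorial))) *
        (∏ i, (w i).supNorm.toReal) * (gradientConst n Θ₀ Λ ^ k * T.mesh.toReal) :=
      mul_le_mul_of_nonneg_left (pow_mul_div_pow_le hη0 hη1 hG hj) (by positivity)
    _ = _ := by ring

/-- The pointwise estimate, integrated over `M`, with a constant that does not depend on the
triangulation and the forms, and on `M` only through its dimension and its volume. -/
theorem SmoothTriangulation.IsCommensurable.l2Norm_whitney_m_deRham_le (hT : T.IsCommensurable Λ)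
    (S : CanonicalLocalExtension) (hmesh : T.mesh ≤ 1) (hΘ₀ : 0 < Θ₀) (hΘ : Θ₀ ≤ T.fullness)
    {j : ℕ} (hj : 3 ≤ j) {w : Fin j → SmoothForm n M} (hw : ∀ i, (w i).supNorm ≠ ⊤) :
    l2Norm (T.whitney (S.m T.K j fun i => T.deRham (w i))) ≤
      (riemannianVolume n M Set.univ ^ (2⁻¹ : ℝ) *
        ENNReal.ofReal (√(∑ k ∈ Finset.range (n + 1), Fintype.card (Fin k ↪o Fin n)) *
          ∑ k ∈ Finset.range (n + 1), whitneyConst S n Θ₀ Λ j k)) *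
        (∏ i, (w i).supNorm) * T.mesh := by
  have hmesh' : T.mesh ≠ ⊤ := ne_top_of_le_ne_top ENNReal.one_ne_top hmesh
  have hη0 : 0 ≤ T.mesh.toReal := ENNReal.toReal_nonneg
  have hP : 0 ≤ ∏ i, (w i).supNorm.toReal := Finset.prod_nonneg fun _ _ => ENNReal.toReal_nonneg
  have hW : 0 ≤ ∑ k ∈ Finset.range (n + 1), whitneyConst S n Θ₀ Λ j k :=
    Finset.sum_nonneg fun k _ => whitneyConst_nonneg S n Θ₀ Λ j k
  obtain ⟨D, hD⟩ : ∃ D, D = ∑ k ∈ Finset.range (n + 1), whitneyConst S n Θ₀ Λ j k := ⟨_, rfl⟩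
  obtain ⟨q, hq⟩ : ∃ q : ℝ, q =
    √(∑ k ∈ Finset.range (n + 1), Fintype.card (Fin k ↪o Fin n)) := ⟨_, rfl⟩
  have hae : ∀ᵐ p ∂(riemannianVolume n M),
      ‖pointwiseNorm p (T.whitney (S.m T.K j fun i => T.deRham (w i)) p)‖ ≤
        q * (D * ((∏ i, (w i).supNorm.toReal) * T.mesh.toReal)) := by
    filter_upwards [hT.ae_exists_simplex] with p ⟨v, hv⟩
    rw [Real.norm_of_nonneg (pointwiseNorm_nonneg p _), hq]
    refine pointwiseNorm_le (by rw [hD]; positivity) fun k hk u hu => ?_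
    refine (hT.abs_whitney_m_deRham_le S hmesh hΘ₀ hΘ hj hw hv hu).trans ?_
    refine mul_le_mul_of_nonneg_right ?_ (by positivity)
    rw [hD]
    exact Finset.single_le_sum (fun k _ => whitneyConst_nonneg S n Θ₀ Λ j k)
      (Finset.mem_range_succ_iff.2 hk)
  refine (eLpNorm_le_of_ae_bound hae).trans (le_of_eq ?_)
  have hq0 : 0 ≤ q := by rw [hq]; positivity
  rw [← hD, ← hq, ← mul_assoc q D, ENNReal.ofReal_mul (mul_nonneg hq0 (by rwa [hD])),
    ENNReal.ofReal_mul hP, ENNReal.ofReal_prod_of_nonneg fun _ _ => ENNReal.toReal_nonneg,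
    ENNReal.ofReal_toReal hmesh']
  simp only [ENNReal.ofReal_toReal (hw _), ENNReal.toReal_ofNat]
  ring

end Estimate
end WhitneyCochains

end

theorem mainTheorem5 (n : ℕ) {M : Type*} [EMetricSpace M]
    [ChartedSpace (EuclideanSpace ℝ (Fin n)) M] [IsManifold (𝓡 n) ∞ M]
    [RiemannianBundle (fun x : M => TangentSpace (𝓡 n) x)]
    [IsContMDiffRiemannianBundle (𝓡 n) ∞ (EuclideanSpace ℝ (Fin n))
      (fun x : M => TangentSpace (𝓡 n) x)]
    [IsRiemannianManifold (𝓡 n) M] [CompactSpace M] [MeasurableSpace M] [BorelSpace M]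
    (S : WhitneyCochains.CanonicalLocalExtension) (Θ₀ Λ : ℝ≥0) (hΘ₀ : 0 < Θ₀) :
    (∀ j : ℕ, 3 ≤ j → ∃ lam : ℝ≥0, ∀ (N : ℕ) (T : WhitneyCochains.SmoothTriangulation n M N),
      T.mesh ≤ 1 → Θ₀ ≤ T.fullness → T.IsCommensurable Λ →
      ∀ w : Fin j → WhitneyCochains.SmoothForm n M,
        WhitneyCochains.l2Norm (T.whitney (S.m T.K j fun i => T.deRham (w i))) ≤
          lam * (∏ i, (w i).supNorm) * T.mesh) ∧
    (∀ (N : ℕ → ℕ) (T : ∀ i : ℕ, WhitneyCochains.SmoothTriangulation n M (N i)),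
      (∀ i, Θ₀ ≤ (T i).fullness) → (∀ i, (T i).IsCommensurable Λ) →
      Filter.Tendsto (fun i => (T i).mesh) Filter.atTop (𝓝 0) →
      ∀ j : ℕ, 3 ≤ j → ∀ w : Fin j → WhitneyCochains.SmoothForm n M,
        Filter.Tendsto (fun i => WhitneyCochains.l2Norm
          ((T i).whitney (S.m (T i).K j fun l => (T i).deRham (w l)))) Filter.atTop (𝓝 0)) := by
  have : IsManifold (𝓡 n) 1 M := .of_le (n := ∞) (by simp)
  have : IsContinuousRiemannianBundle (EuclideanSpace ℝ (Fin n))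
      (fun x : M => TangentSpace (𝓡 n) x) := by
    obtain ⟨g, hg, hg'⟩ := IsContMDiffRiemannianBundle.exists_contMDiff (IB := 𝓡 n) (n := ∞)
      (F := EuclideanSpace ℝ (Fin n)) (E := fun x : M => TangentSpace (𝓡 n) x)
    exact ⟨g, hg.continuous, hg'⟩
  have key : ∀ j : ℕ, 3 ≤ j → ∃ lam : ℝ≥0,
      ∀ (N : ℕ) (T : WhitneyCochains.SmoothTriangulation n M N),
      T.mesh ≤ 1 → Θ₀ ≤ T.fullness → T.IsCommensurable Λ →
      ∀ w : Fin j → WhitneyCochains.SmoothForm n M,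
        WhitneyCochains.l2Norm (T.whitney (S.m T.K j fun i => T.deRham (w i))) ≤
          lam * (∏ i, (w i).supNorm) * T.mesh := by
    intro j hj
    -- If `M` had infinite volume, it would have no commensurable triangulation, and the value of
    -- `ENNReal.toNNReal` would be irrelevant.
    refine ⟨(WhitneyCochains.riemannianVolume n M Set.univ ^ (2⁻¹ : ℝ) *
      ENNReal.ofReal (√(∑ k ∈ Finset.range (n + 1), Fintype.card (Fin k ↪o Fin n)) *
        ∑ k ∈ Finset.range (n + 1), WhitneyCochains.whitneyConst S n Θ₀ Λ j k)).toNNReal,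
      fun N T hmesh hΘ hT w => ?_⟩
    · refine (hT.l2Norm_whitney_m_deRham_le S hmesh hΘ₀ hΘ hj fun i => (w i).supNorm_ne_top).trans
        (le_of_eq ?_)
      rw [ENNReal.coe_toNNReal]
      exact ENNReal.mul_ne_top (ENNReal.rpow_ne_top_of_nonneg (by norm_num)
        hT.riemannianVolume_univ_ne_top) ENNReal.ofReal_ne_top
  refine ⟨key, fun N T hΘ hT hmesh j hj w => ?_⟩
  obtain ⟨lam, hlam⟩ := key j hj
  have hfin : (lam : ℝ≥0∞) * ∏ i, (w i).supNorm ≠ ⊤ :=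
    ENNReal.mul_ne_top ENNReal.coe_ne_top
      (ENNReal.prod_ne_top fun i _ => (w i).supNorm_ne_top)
  have hlim := ENNReal.Tendsto.const_mul hmesh (Or.inr hfin)
  rw [mul_zero] at hlim
  refine tendsto_of_tendsto_of_tendsto_of_le_of_le' tendsto_const_nhds hlim
    (Filter.Eventually.of_forall fun _ => zero_le) ?_
  filter_upwards [hmesh.eventually_lt_const zero_lt_one] with i hi
  exact hlam (N i) (T i) hi.le (hΘ i) (hT i) w
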